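/- Let $(G,+)$ be a finite abelian group, $G^*=G\setminus\{0\}$. For $D\subseteq G$ write $D$ also for $\sum_{x\in D}x\in\mathbb Z[G]$, put $D^{(-1)}=\{-x:x\in D\}$ and $\overline D=G^*\setminus D$. An indexed family $D_1,\dots,D_\ell$ of (not necessarily distinct) subsets of $G$ is a difference family with parameter $\lambda\in\mathbb Z$ if every $g\in G^*$ occurs exactly $\lambda$ times in the list of differences $x-y$ with $x,y\in D_i$, $x\neq y$, $1\le i\le\ell$. It is symmetric if $D_i=D_i^{(-1)}$ for all $i$. A difference family with four blocks is of type $H$ if $\lambda=\sum_i|D_i|-|G|$, and of type $H_4^*$ if $\lambda=\sum_i|D_i|-(|G|+1)$. For a difference family $D_0,D_1,D_2,D_3$ of type $H$ in $G$ consider the conditions (d1) $0\notin\bigcup_{i=0}^3D_i$; (d2) there are $E_0,E_1\subseteq G^*$ with $D_0+D_1-D_2-D_3=E_0-\overline E_0$ and $D_0+D_3-D_1-D_2=E_1-\overline E_1$ in $\mathbb Z[G]$ such that $E_0,E_1,\overline E_0,\overline E_1$ form a difference family of type $H_4^*$; (d3) $D_0D_2^{(-1)}+D_2D_0^{(-1)}+D_1D_3^{(-1)}+D_3D_1^{(-1)}=\bigl(\sum_{i=0}^3|D_i|-|G|+1\bigr)G$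 in $\mathbb Z[G]$; (d4) the coefficient of each $x\in G^*$ in $\sum_{i=0}^3D_i$ is one or three, the coefficient of $0$ in $\sum_{i=0}^3D_i$ is even, and it is not the case that exactly one of $D_0+D_1$, $D_2+D_3$, $D_0+D_3$, $D_1+D_2$ has coefficient two at $0$; (d5) $|D_0|+|D_3|=|D_1|+|D_2|$. Theorem. Let $s\ge 0$, let $p_1,\dots,p_s$ be distinct odd primes, let $t_1,\dots,t_s$ be nonnegative integers, and let $G=N\times\mathbb Z_{p_1}^{4t_1}\times\cdots\times\mathbb Z_{p_s}^{4t_s}$, where $N=\{0\}$ or $N=\mathbb Z_3^2$. Then there exists a symmetric difference family $D_0,D_1,D_2,D_3$ of type $H$ in $G$ satisfying (d1)-(d5). -/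

import Mathlib

open scoped BigOperators

/-- The element `∑ x ∈ D, x` of the group ring `ℤ[G]` attached to a subset `D` of `G`. -/
noncomputable def blockSum {G : Type*} [AddCommGroup G] (D : Finset G) : AddMonoidAlgebra ℤ G :=
  ∑ x ∈ D, AddMonoidAlgebra.single x 1

/-- `D^{(-1)} = {-x : x ∈ D}`. -/
def negBlock {G : Type*} [AddCommGroup G] (D : Finset G) : Finset G :=
  D.map (Equiv.neg G).toEmbedding

/-- The complement of `D` in `G^* = G \ {0}`. -/
def starCompl {G : Type*} [AddCommGroup G] [Fintype G] [DecidableEq G] (D : Finset G) : Finset G :=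
  (Finset.univ.erase 0) \ D

/-- The family `B` is symmetric: each block satisfies `D = D^{(-1)}`. -/
def IsSymmetricFamily {G ι : Type*} [AddCommGroup G] (B : ι → Finset G) : Prop :=
  ∀ i, B i = negBlock (B i)

/-- The (indexed) family `B` of subsets of `G` is a difference family with parameter `lam`
(the other parameters are `|G|` and the block sizes): every `g ≠ 0` occurs exactly `lam` times
in the list of differences `x - y`, `x, y ∈ B i`, `x ≠ y`. -/
def IsDifferenceFamily {G ι : Type*} [AddCommGroup G] [DecidableEq G] [Fintype ι]
    (B : ι → Finset G) (lam : ℤ) : Prop :=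
  ∀ g : G, g ≠ 0 →
    ∑ i, ((((B i) ×ˢ (B i)).filter (fun xy => xy.1 ≠ xy.2 ∧ xy.1 - xy.2 = g)).card : ℤ) = lam

/-- Difference family of type `H`: four blocks and `lam = ∑ kᵢ - |G|`. -/
def IsTypeH {G : Type*} [AddCommGroup G] [Fintype G] [DecidableEq G]
    (B : Fin 4 → Finset G) : Prop :=
  IsDifferenceFamily B (∑ i, ((B i).card : ℤ) - (Fintype.card G : ℤ))

/-- Difference family of type `H₄^*`: four blocks and `lam = ∑ kᵢ - 4 (|G| + 1) / 4`. -/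
def IsTypeHFourStar {G : Type*} [AddCommGroup G] [Fintype G] [DecidableEq G]
    (B : Fin 4 → Finset G) : Prop :=
  IsDifferenceFamily B (∑ i, ((B i).card : ℤ) - ((Fintype.card G : ℤ) + 1))

/-- `0` lies in no block. -/
def CondD1 {G : Type*} [AddCommGroup G] (D : Fin 4 → Finset G) : Prop :=
  ∀ i, (0 : G) ∉ D i

/-- There are `E₀, E₁ ⊆ G^*` with `D₀ + D₁ - D₂ - D₃ = E₀ - E₀'` and
`D₀ + D₃ - D₁ - D₂ = E₁ - E₁'` in `ℤ[G]`, where `E'` is the complement of `E` in `G^*`, such that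
`E₀, E₁, E₀', E₁'` form a difference family of type `H₄^*`. -/
def CondD2 {G : Type*} [AddCommGroup G] [Fintype G] [DecidableEq G]
    (D : Fin 4 → Finset G) : Prop :=
  ∃ E₀ E₁ : Finset G, (0 : G) ∉ E₀ ∧ (0 : G) ∉ E₁ ∧
    blockSum (D 0) + blockSum (D 1) - blockSum (D 2) - blockSum (D 3)
      = blockSum E₀ - blockSum (starCompl E₀) ∧
    blockSum (D 0) + blockSum (D 3) - blockSum (D 1) - blockSum (D 2)
      = blockSum E₁ - blockSum (starCompl E₁) ∧
    IsTypeHFourStar ![E₀, E₁, starCompl E₀, starCompl E₁]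

/-- `D₀D₂^{(-1)} + D₂D₀^{(-1)} + D₁D₃^{(-1)} + D₃D₁^{(-1)} = (∑ |Dᵢ| - |G| + 1) G` in `ℤ[G]`. -/
def CondD3 {G : Type*} [AddCommGroup G] [Fintype G] (D : Fin 4 → Finset G) : Prop :=
  blockSum (D 0) * blockSum (negBlock (D 2)) + blockSum (D 2) * blockSum (negBlock (D 0))
    + blockSum (D 1) * blockSum (negBlock (D 3)) + blockSum (D 3) * blockSum (negBlock (D 1))
  = (∑ i, ((D i).card : ℤ) - (Fintype.card G : ℤ) + 1) • blockSum (Finset.univ : Finset G)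

/-- Every `x ≠ 0` has coefficient one or three in `∑ Dᵢ`; the coefficient of `0` in `∑ Dᵢ` is even,
and it is not the case that exactly one of `D₀ + D₁`, `D₂ + D₃`, `D₀ + D₃`, `D₁ + D₂` has
coefficient two at `0`. -/
def CondD4 {G : Type*} [AddCommGroup G] (D : Fin 4 → Finset G) : Prop :=
  (∀ x : G, x ≠ 0 →
    (∑ i, blockSum (D i)).coeff x = 1 ∨ (∑ i, blockSum (D i)).coeff x = 3) ∧
  Even ((∑ i, blockSum (D i)).coeff 0) ∧
  ¬ ∃! j : Fin 4,
      ((![blockSum (D 0) + blockSum (D 1), blockSum (D 2) + blockSum (D 3),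
          blockSum (D 0) + blockSum (D 3), blockSum (D 1) + blockSum (D 2)] :
          Fin 4 → AddMonoidAlgebra ℤ G) j).coeff 0 = 2

/-- `|D₀| + |D₃| = |D₁| + |D₂|`. -/
def CondD5 {G : Type*} (D : Fin 4 → Finset G) : Prop :=
  (D 0).card + (D 3).card = (D 1).card + (D 2).card

/-!
Write `A i = G - 2 D i` for the `±1` functions of the blocks, and put `U = (A 0 + A 2) / 2`,
`V = (A 0 - A 2) / 2`, `W = (A 1 + A 3) / 2`, `Z = (A 1 - A 3) / 2` in `ℤ[G]`. All the required
conditions follow from the properties collected in `IsRowQuadruple`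
(`exists_family_of_rowQuadruple`): the matrix `!![U, Z; V, W]` is the identity at `0`, has a single
nonzero row with entries `±1` at every other point, and satisfies
`U Z = V W = 0`, `U² - V² = W² - Z² = G`, `U² + Z² = |G|`. The last relations say that at every
nontrivial character the matrix has a single nonzero column with entries `±√|G|`.

Both properties survive matrix multiplication, so if `G` and `H` carry such quadruples, the matrix
product over `ℤ[G × H]` is one for `G × H` (`HasRowQuadruple.prod`). This leaves the groups
`ℤ₃²` and `ℤ_p⁴`. For `ℤ₃²` the quadruple is built from the four lines through the origin.

For `ℤ_p⁴ = F × F` with `F = 𝔽_{p²}`, take the spread of the `p² + 1` lines of `F × F` through the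
origin. Let `χ` be the quadratic character of `F`, and consider functions `f` with
`f (a v) = χ a f v`. Summing `f` over the affine lines `det (v, u) = 1` is an operator on them, the
Paley conference matrix. It has an eigenvector `w` with values `±1` and eigenvalue `p`, namely a sign
function constant on the cosets of the prime field (`lineSum_homogenize`), and stretching a
coordinate by a nonsquare gives another one, `w'`, with eigenvalue `-p` (`lineSum_comp_stretch`).
Hence `V = (w + w') / 2` and `Z = (w - w') / 2` have complementary supports and are exchanged by the
operator, up to the factor `p`. Let `W` be a sum, with signs adding up to one, of the lines on which
`V` does not vanish, and `U` such a sum of the lines on which `Z` does not vanish; the signs exist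
because both supports consist of `(p² + 1) / 2` lines, an odd number. The relations in the group
ring follow from the formula for `Z * Z` in `ofFun_mul_self_eq_sum_lineElt` and from the products of
lines, so no complex characters are needed.
-/

open AddMonoidAlgebra

/-! ### Coefficients in the group ring -/

section GroupRing

variable {G : Type*} [AddCommGroup G]

lemma coeff_blockSum [DecidableEq G] (D : Finset G) (x : G) :
    (blockSum D).coeff x = if x ∈ D then 1 else 0 := by
  simp [blockSum, coeff_sum, Finsupp.finsetSum_apply, Finsupp.single_apply]

lemma coeff_blockSum_univ [Fintype G] (x : G) :
    (blockSum (Finset.univ : Finset G)).coeff x = 1 := by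
  classical simp [coeff_blockSum]

lemma coeff_natCast_apply [DecidableEq G] (k : ℕ) (x : G) :
    (k : AddMonoidAlgebra ℤ G).coeff x = if x = 0 then (k : ℤ) else 0 := by
  rw [coeff_natCast, Finsupp.single_apply]; simp [eq_comm]

lemma coeff_mul_eq_sum [Fintype G] (a b : AddMonoidAlgebra ℤ G) (x : G) :
    (a * b).coeff x = ∑ y, a.coeff y * b.coeff (x - y) := by
  rw [coeff_mul_apply_left, Finsupp.sum_fintype _ _ (by simp)]
  simp [neg_add_eq_sub]

lemma mul_blockSum_univ [Fintype G] (a : AddMonoidAlgebra ℤ G) :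
    a * blockSum (Finset.univ : Finset G) =
      (∑ x, a.coeff x : ℤ) • blockSum (Finset.univ : Finset G) := by
  ext x
  simp [-zsmul_eq_mul, coeff_mul_eq_sum, coeff_blockSum_univ]

end GroupRing

/-- The element of `ℤ[G]` with prescribed coefficients. -/
noncomputable def ofFun {G : Type*} [Fintype G] (f : G → ℤ) : AddMonoidAlgebra ℤ G :=
  ofCoeff (Finsupp.equivFunOnFinite.symm f)

@[simp] lemma coeff_ofFun {G : Type*} [Fintype G] (f : G → ℤ) (x : G) : (ofFun f).coeff x = f x :=
  rfl

/-! ### Quadruples and their composition -/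

/-- A quadruple `U, V, W, Z` of elements of `ℤ[G]` with even coefficients, read as the matrix
`!![U, Z; V, W]` over `ℤ[G]`. The coefficient matrix is the identity at `0`, and at every other
point it has exactly one nonzero row, with entries `±1`. The remaining fields are relations in the
group ring; on the Fourier side they say that at each nontrivial character the matrix has exactly
one nonzero column, with entries `±√|G|`. -/
structure IsRowQuadruple {G : Type*} [AddCommGroup G] [Fintype G]
    (U V W Z : AddMonoidAlgebra ℤ G) : Prop where
  U_neg : ∀ x, U.coeff (-x) = U.coeff x
  V_neg : ∀ x, V.coeff (-x) = V.coeff x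
  W_neg : ∀ x, W.coeff (-x) = W.coeff x
  Z_neg : ∀ x, Z.coeff (-x) = Z.coeff x
  U_zero : U.coeff 0 = 1
  V_zero : V.coeff 0 = 0
  W_zero : W.coeff 0 = 1
  Z_zero : Z.coeff 0 = 0
  row : ∀ x, x ≠ 0 →
    (IsUnit (U.coeff x) ∧ IsUnit (Z.coeff x) ∧ V.coeff x = 0 ∧ W.coeff x = 0) ∨
    (U.coeff x = 0 ∧ Z.coeff x = 0 ∧ IsUnit (V.coeff x) ∧ IsUnit (W.coeff x))
  U_mul_Z : U * Z = 0
  V_mul_W : V * W = 0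
  U_sq : U * U = V * V + blockSum Finset.univ
  W_sq : W * W = Z * Z + blockSum Finset.univ
  norm_row : U * U + Z * Z = (Fintype.card G : AddMonoidAlgebra ℤ G)

/-- The group `G` carries a quadruple as in `IsRowQuadruple`. -/
def HasRowQuadruple (G : Type) [AddCommGroup G] [Fintype G] : Prop :=
  ∃ U V W Z : AddMonoidAlgebra ℤ G, IsRowQuadruple U V W Z

lemma hasRowQuadruple_of_subsingleton (G : Type) [AddCommGroup G] [Fintype G] [Subsingleton G] :
    HasRowQuadruple G := by
  have h : (blockSum Finset.univ : AddMonoidAlgebra ℤ G) = 1 := by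
    ext x; obtain rfl := Subsingleton.elim x 0; simp [coeff_blockSum_univ]
  have hc : Fintype.card G = 1 :=
    le_antisymm (Fintype.card_le_one_iff_subsingleton.2 ‹_›) Fintype.card_pos
  refine ⟨1, 0, 1, 0, ?_⟩
  constructor <;> simp [h, hc, Subsingleton.elim _ (0 : G)]

lemma HasRowQuadruple.of_addEquiv {G H : Type} [AddCommGroup G] [Fintype G] [AddCommGroup H]
    [Fintype H] (e : G ≃+ H) (h : HasRowQuadruple G) : HasRowQuadruple H := by
  obtain ⟨U, V, W, Z, h⟩ := h
  let φ := domCongr ℤ ℤ e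
  have hJ : φ (blockSum Finset.univ) = blockSum Finset.univ := by
    ext x; simp [φ, coeff_domCongr, coeff_blockSum_univ]
  have hcard : Fintype.card G = Fintype.card H := Fintype.card_congr e.toEquiv
  refine ⟨φ U, φ V, φ W, φ Z, ?_⟩
  constructor
  · simp [φ, coeff_domCongr, h.U_neg]
  · simp [φ, coeff_domCongr, h.V_neg]
  · simp [φ, coeff_domCongr, h.W_neg]
  · simp [φ, coeff_domCongr, h.Z_neg]
  · simp [φ, coeff_domCongr, h.U_zero]
  · simp [φ, coeff_domCongr, h.V_zero]
  · simp [φ, coeff_domCongr, h.W_zero]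
  · simp [φ, coeff_domCongr, h.Z_zero]
  · intro x hx
    simpa only [φ, coeff_domCongr] using h.row (e.symm x) (by simpa using hx)
  · rw [← map_mul, h.U_mul_Z, map_zero]
  · rw [← map_mul, h.V_mul_W, map_zero]
  · rw [← map_mul, ← map_mul, ← hJ, ← map_add, h.U_sq]
  · rw [← map_mul, ← map_mul, ← hJ, ← map_add, h.W_sq]
  · rw [← map_mul, ← map_mul, ← map_add, h.norm_row, map_natCast, hcard]

section Product

variable {G H : Type*} [AddCommGroup G] [AddCommGroup H]

/-- The embedding `ℤ[G] → ℤ[G × H]`. -/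
noncomputable def inlHom (G H : Type*) [AddCommGroup G] [AddCommGroup H] :
    AddMonoidAlgebra ℤ G →+* AddMonoidAlgebra ℤ (G × H) :=
  mapDomainRingHom ℤ (AddMonoidHom.inl G H)

/-- The embedding `ℤ[H] → ℤ[G × H]`. -/
noncomputable def inrHom (G H : Type*) [AddCommGroup G] [AddCommGroup H] :
    AddMonoidAlgebra ℤ H →+* AddMonoidAlgebra ℤ (G × H) :=
  mapDomainRingHom ℤ (AddMonoidHom.inr G H)

lemma coeff_inlHom_mul_inrHom (a : AddMonoidAlgebra ℤ G) (b : AddMonoidAlgebra ℤ H) (x : G × H) :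
    (inlHom G H a * inrHom G H b).coeff x = a.coeff x.1 * b.coeff x.2 := by
  classical
  induction a using AddMonoidAlgebra.induction_linear with
  | zero => simp
  | add a a' ha ha' => simp [add_mul, ha, ha']
  | single g r =>
    induction b using AddMonoidAlgebra.induction_linear with
    | zero => simp
    | add b b' hb hb' => simp only [map_add, mul_add, coeff_add, Finsupp.add_apply, hb, hb']
    | single h s =>
      obtain ⟨y, z⟩ := x
      simp only [inlHom, inrHom, mapDomainRingHom_apply, mapDomain_single, AddMonoidHom.inl_apply,
        AddMonoidHom.inr_apply, single_mul_single, coeff_single, Finsupp.single_apply,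
        Prod.mk_add_mk, add_zero, zero_add, Prod.mk.injEq]
      by_cases h1 : g = y <;> by_cases h2 : h = z <;> simp [h1, h2]

/-- The quadruples multiply as `2 × 2` matrices. A product of two matrices with a single nonzero
row again has a single nonzero row, and the relations in the group ring are inherited because
`U Z = V W = 0` removes every cross term. -/
theorem HasRowQuadruple.prod {G H : Type} [AddCommGroup G] [Fintype G] [AddCommGroup H] [Fintype H]
    (hG : HasRowQuadruple G) (hH : HasRowQuadruple H) : HasRowQuadruple (G × H) := by
  obtain ⟨U, V, W, Z, h⟩ := hG
  obtain ⟨U', V', W', Z', h'⟩ := hH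
  set i := inlHom G H with hi
  set j := inrHom G H with hj
  have hJ : i (blockSum Finset.univ) * j (blockSum Finset.univ) = blockSum Finset.univ := by
    ext x; simp [hi, hj, coeff_inlHom_mul_inrHom, coeff_blockSum_univ]
  have a1 : i U * i Z = 0 := by rw [← map_mul, h.U_mul_Z, map_zero]
  have a2 : i V * i W = 0 := by rw [← map_mul, h.V_mul_W, map_zero]
  have a3 : i U * i U = i V * i V + i (blockSum Finset.univ) := by
    rw [← map_mul, ← map_mul, ← map_add, h.U_sq]
  have a4 : i W * i W = i Z * i Z + i (blockSum Finset.univ) := by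
    rw [← map_mul, ← map_mul, ← map_add, h.W_sq]
  have a5 : i U * i U + i Z * i Z = (Fintype.card G : AddMonoidAlgebra ℤ (G × H)) := by
    rw [← map_mul, ← map_mul, ← map_add, h.norm_row, map_natCast]
  have b1 : j U' * j Z' = 0 := by rw [← map_mul, h'.U_mul_Z, map_zero]
  have b2 : j V' * j W' = 0 := by rw [← map_mul, h'.V_mul_W, map_zero]
  have b3 : j U' * j U' = j V' * j V' + j (blockSum Finset.univ) := by
    rw [← map_mul, ← map_mul, ← map_add, h'.U_sq]
  have b4 : j W' * j W' = j Z' * j Z' + j (blockSum Finset.univ) := by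
    rw [← map_mul, ← map_mul, ← map_add, h'.W_sq]
  have b5 : j U' * j U' + j Z' * j Z' = (Fintype.card H : AddMonoidAlgebra ℤ (G × H)) := by
    rw [← map_mul, ← map_mul, ← map_add, h'.norm_row, map_natCast]
  refine ⟨i U * j U' + i Z * j V', i V * j U' + i W * j V', i V * j Z' + i W * j W',
    i U * j Z' + i Z * j W', ?_⟩
  constructor
  · simp [hi, hj, coeff_inlHom_mul_inrHom, h.U_neg, h.Z_neg, h'.U_neg, h'.V_neg]
  · simp [hi, hj, coeff_inlHom_mul_inrHom, h.V_neg, h.W_neg, h'.U_neg, h'.V_neg]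
  · simp [hi, hj, coeff_inlHom_mul_inrHom, h.V_neg, h.W_neg, h'.Z_neg, h'.W_neg]
  · simp [hi, hj, coeff_inlHom_mul_inrHom, h.U_neg, h.Z_neg, h'.Z_neg, h'.W_neg]
  · simp [hi, hj, coeff_inlHom_mul_inrHom, h.U_zero, h.Z_zero, h'.U_zero, h'.V_zero]
  · simp [hi, hj, coeff_inlHom_mul_inrHom, h.V_zero, h.W_zero, h'.U_zero, h'.V_zero]
  · simp [hi, hj, coeff_inlHom_mul_inrHom, h.V_zero, h.W_zero, h'.Z_zero, h'.W_zero]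
  · simp [hi, hj, coeff_inlHom_mul_inrHom, h.U_zero, h.Z_zero, h'.Z_zero, h'.W_zero]
  · rintro ⟨x, y⟩ hxy
    -- One factor is the identity matrix if `x = 0` or `y = 0`; otherwise both have a single row.
    simp only [hi, hj, coeff_add, Finsupp.add_apply, coeff_inlHom_mul_inrHom]
    by_cases hx : x = 0
    · subst hx
      have hy : y ≠ 0 := by rintro rfl; exact hxy rfl
      rcases h'.row y hy with ⟨u1, u2, u3, u4⟩ | ⟨u1, u2, u3, u4⟩ <;>
        simp [h.U_zero, h.V_zero, h.W_zero, h.Z_zero, u1, u2, u3, u4]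
    · by_cases hy : y = 0
      · subst hy
        rcases h.row x hx with ⟨u1, u2, u3, u4⟩ | ⟨u1, u2, u3, u4⟩ <;>
          simp [h'.U_zero, h'.V_zero, h'.W_zero, h'.Z_zero, u1, u2, u3, u4]
      · rcases h.row x hx with ⟨u1, u2, u3, u4⟩ | ⟨u1, u2, u3, u4⟩ <;>
          rcases h'.row y hy with ⟨v1, v2, v3, v4⟩ | ⟨v1, v2, v3, v4⟩ <;>
          simp [u1, u2, u3, u4, v1, v2, v3, v4]
  · linear_combination (j U' * j W' + j V' * j Z') * a1 + i U * i U * b1 + i Z * i Z * b2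
  · linear_combination (j U' * j W' + j V' * j Z') * a2 + i V * i V * b1 + i W * i W * b2
  · linear_combination j U' * j U' * a3 - j V' * j V' * a4 + i (blockSum Finset.univ) * b3
      + 2 * j U' * j V' * (a1 - a2) + hJ
  · linear_combination j W' * j W' * a4 - j Z' * j Z' * a3 + i (blockSum Finset.univ) * b4
      + 2 * j Z' * j W' * (a2 - a1) + hJ
  · rw [Fintype.card_prod, Nat.cast_mul]
    linear_combination i U * i U * b5 + i Z * i Z * (b5 - b3 + b4)
      + (Fintype.card H : AddMonoidAlgebra ℤ (G × H)) * a5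
      + 2 * (j U' * j V' + j Z' * j W') * a1

end Product

/-! ### From a quadruple to the four blocks -/

section Blocks

variable {G : Type*} [AddCommGroup G] [Fintype G] [DecidableEq G]

omit [Fintype G] [DecidableEq G] in
lemma negBlock_eq_self {D : Finset G} (hD : ∀ x, -x ∈ D ↔ x ∈ D) : negBlock D = D := by
  ext x
  simp only [negBlock, Finset.mem_map, Equiv.coe_toEmbedding, Equiv.neg_apply]
  constructor
  · rintro ⟨y, hy, rfl⟩; exact (hD y).2 hy
  · intro hx; exact ⟨-x, (hD x).2 hx, neg_neg x⟩

/-- For a symmetric block, the number of representations of `g ≠ 0` as a difference is the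
coefficient at `g` of the square of the block. -/
lemma card_differences_eq_coeff_sq {D : Finset G} (hD : ∀ x, -x ∈ D ↔ x ∈ D) {g : G} (hg : g ≠ 0) :
    (((D ×ˢ D).filter (fun xy => xy.1 ≠ xy.2 ∧ xy.1 - xy.2 = g)).card : ℤ) =
      (blockSum D * blockSum D).coeff g := by
  have h1 : ((D ×ˢ D).filter (fun xy => xy.1 ≠ xy.2 ∧ xy.1 - xy.2 = g)) =
      (D.filter (fun x => g - x ∈ D)).map ⟨fun x => (x, x - g), fun a b h => (Prod.ext_iff.1 h).1⟩ := by
    ext ⟨x, y⟩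
    simp only [Finset.mem_filter, Finset.mem_product, Finset.mem_map]
    constructor
    · rintro ⟨⟨hx, hy⟩, -, rfl⟩
      refine ⟨x, ⟨hx, ?_⟩, Prod.ext rfl (sub_sub_cancel x y)⟩
      have : x - y - x = -y := by abel
      rw [this]; exact (hD y).2 hy
    · rintro ⟨x, ⟨hx, hx'⟩, h⟩
      obtain ⟨rfl, rfl⟩ := Prod.mk.inj h
      refine ⟨⟨hx, ?_⟩, ?_, by abel⟩
      · rw [← hD]; simpa using hx'
      · intro h; apply hg; simpa using h.symm
  rw [h1, Finset.card_map, coeff_mul_eq_sum]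
  simp only [coeff_blockSum, mul_ite, mul_one, mul_zero, Finset.card_filter]
  rw [← Finset.sum_subset (Finset.subset_univ D)]
  · push_cast
    exact Finset.sum_congr rfl fun x hx => by simp [hx]
  · intro x _ hx; simp [hx]

lemma isDifferenceFamily_of_coeff {ι : Type*} [Fintype ι] {B : ι → Finset G} {lam : ℤ}
    (hB : ∀ i x, -x ∈ B i ↔ x ∈ B i)
    (h : ∀ g, g ≠ 0 → (∑ i, blockSum (B i) * blockSum (B i)).coeff g = lam) :
    IsDifferenceFamily B lam := by
  intro g hg
  rw [← h g hg, coeff_sum, Finsupp.finsetSum_apply]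
  exact Finset.sum_congr rfl fun i _ => card_differences_eq_coeff_sq (hB i) hg

lemma sum_coeff_blockSum (D : Finset G) : ∑ x, (blockSum D).coeff x = (D.card : ℤ) := by
  simp [coeff_blockSum]

omit [DecidableEq G] in
lemma sum_coeff_mul (a b : AddMonoidAlgebra ℤ G) :
    ∑ x, (a * b).coeff x = (∑ x, a.coeff x) * ∑ x, b.coeff x := by
  simp only [coeff_mul_eq_sum]
  rw [Finset.sum_comm, Finset.sum_mul]
  refine Finset.sum_congr rfl fun y _ => ?_
  rw [← Finset.mul_sum]
  congr 1
  exact Equiv.sum_comp (Equiv.subRight y) (fun x => b.coeff x)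

end Blocks

/-- The block of a `±1`-valued element `A` of `ℤ[G]`: the points where `A` is `-1`. -/
def minusBlock {G : Type*} [AddCommGroup G] [Fintype G] (A : AddMonoidAlgebra ℤ G) : Finset G :=
  Finset.univ.filter fun x => A.coeff x = -1

lemma mem_minusBlock {G : Type*} [AddCommGroup G] [Fintype G] {A : AddMonoidAlgebra ℤ G} {x : G} :
    x ∈ minusBlock A ↔ A.coeff x = -1 := by
  simp [minusBlock]

section Conclusion

variable {G : Type*} [AddCommGroup G] [Fintype G] [DecidableEq G]

lemma two_mul_blockSum_minusBlock {A : AddMonoidAlgebra ℤ G} (hA : ∀ x, IsUnit (A.coeff x)) :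
    2 * blockSum (minusBlock A) = blockSum Finset.univ - A := by
  ext x
  rw [two_mul, coeff_add, Finsupp.add_apply, coeff_sub, Finsupp.sub_apply, coeff_blockSum,
    coeff_blockSum_univ]
  rcases Int.isUnit_iff.1 (hA x) with h | h <;> simp [mem_minusBlock, h]

omit [DecidableEq G] in
lemma minusBlock_neg_mem {A : AddMonoidAlgebra ℤ G} (hA : ∀ x, A.coeff (-x) = A.coeff x) (x : G) :
    -x ∈ minusBlock A ↔ x ∈ minusBlock A := by
  simp [mem_minusBlock, hA]

/-- For `e` with value `0` at `0` and `±1` elsewhere, `e` is the difference of the complement of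
`minusBlock e` in `G \ {0}` and `minusBlock e`. -/
lemma two_mul_blockSum_star {e : AddMonoidAlgebra ℤ G} (he : ∀ x, x ≠ 0 → IsUnit (e.coeff x))
    (he0 : e.coeff 0 = 0) :
    2 * blockSum (minusBlock e) = blockSum Finset.univ - 1 - e ∧
    2 * blockSum (starCompl (minusBlock e)) = blockSum Finset.univ - 1 + e := by
  constructor <;> ext x
  all_goals
    simp only [two_mul, coeff_add, Finsupp.add_apply, coeff_sub, Finsupp.sub_apply, coeff_blockSum,
      one_def, coeff_single, Finsupp.single_apply]
    by_cases hx : x = 0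
    · subst hx; simp [mem_minusBlock, starCompl, he0]
    · rcases Int.isUnit_iff.1 (he x hx) with h | h <;>
        simp [mem_minusBlock, starCompl, h, hx, Ne.symm hx]

omit [Fintype G] [DecidableEq G] in
lemma eq_of_two_mul_eq {a b : AddMonoidAlgebra ℤ G} (h : 2 * a = 2 * b) : a = b := by
  ext x
  have := congrArg (fun c : AddMonoidAlgebra ℤ G => c.coeff x) h
  simp only [two_mul, coeff_add, Finsupp.add_apply] at this
  omega

lemma card_add_card_starCompl {E : Finset G} (hE : (0 : G) ∉ E) :
    (E.card : ℤ) + (starCompl E).card = Fintype.card G - 1 := by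
  have h1 : E ⊆ Finset.univ.erase 0 := fun x hx =>
    Finset.mem_erase.2 ⟨fun h => hE (h ▸ hx), Finset.mem_univ x⟩
  have h2 := Finset.card_sdiff_add_card_eq_card h1
  have h3 := Finset.card_erase_add_one (Finset.mem_univ (0 : G))
  rw [Finset.card_univ] at h3
  unfold starCompl
  omega

/-- The blocks are the sets where `U + V`, `W + Z`, `U - V`, `W - Z` take the value `-1`. -/
theorem exists_family_of_rowQuadruple {U V W Z : AddMonoidAlgebra ℤ G}
    (h : IsRowQuadruple U V W Z) :
    ∃ D : Fin 4 → Finset G, IsTypeH D ∧ IsSymmetricFamily D ∧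
        CondD1 D ∧ CondD2 D ∧ CondD3 D ∧ CondD4 D ∧ CondD5 D := by
  set J : AddMonoidAlgebra ℤ G := blockSum Finset.univ with hJ
  have unitA : ∀ x, IsUnit ((U + V).coeff x) ∧ IsUnit ((W + Z).coeff x) ∧
      IsUnit ((U - V).coeff x) ∧ IsUnit ((W - Z).coeff x) := by
    intro x
    by_cases hx : x = 0
    · subst hx; simp [h.U_zero, h.V_zero, h.W_zero, h.Z_zero]
    · rcases h.row x hx with ⟨u1, u2, u3, u4⟩ | ⟨u1, u2, u3, u4⟩ <;> simp [u1, u2, u3, u4]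
  have unitE : ∀ x, x ≠ 0 → IsUnit ((V + Z).coeff x) ∧ IsUnit ((V - Z).coeff x) := by
    intro x hx
    rcases h.row x hx with ⟨-, u2, u3, -⟩ | ⟨-, u2, u3, -⟩ <;> simp [u2, u3]
  set D : Fin 4 → Finset G :=
    ![minusBlock (U + V), minusBlock (W + Z), minusBlock (U - V), minusBlock (W - Z)] with hD
  have e0 : U + V = J - 2 * blockSum (D 0) := by
    have := two_mul_blockSum_minusBlock fun x => (unitA x).1
    simp only [hD, Matrix.cons_val]; rw [this]; ring
  have e1 : W + Z = J - 2 * blockSum (D 1) := by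
    have := two_mul_blockSum_minusBlock fun x => (unitA x).2.1
    simp only [hD, Matrix.cons_val]; rw [this]; ring
  have e2 : U - V = J - 2 * blockSum (D 2) := by
    have := two_mul_blockSum_minusBlock fun x => (unitA x).2.2.1
    simp only [hD, Matrix.cons_val]; rw [this]; ring
  have e3 : W - Z = J - 2 * blockSum (D 3) := by
    have := two_mul_blockSum_minusBlock fun x => (unitA x).2.2.2
    simp only [hD, Matrix.cons_val]; rw [this]; ring
  have hsymm : ∀ i x, -x ∈ D i ↔ x ∈ D i := by
    intro i x
    fin_cases i <;> exact minusBlock_neg_mem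
      (fun y => by simp [h.U_neg, h.V_neg, h.W_neg, h.Z_neg]) x
  have hneg : ∀ i, negBlock (D i) = D i := fun i => negBlock_eq_self (hsymm i)
  have hJJ : J * J = (Fintype.card G : AddMonoidAlgebra ℤ G) * J := by
    rw [hJ, mul_blockSum_univ]; simp [coeff_blockSum_univ]
  have hk : ∀ i, blockSum (D i) * J = ((D i).card : AddMonoidAlgebra ℤ G) * J := by
    intro i
    rw [hJ, mul_blockSum_univ, sum_coeff_blockSum]; simp
  have hzero : ∀ i, (0 : G) ∉ D i := by
    intro i
    fin_cases i <;> simp [hD, mem_minusBlock, h.U_zero, h.V_zero, h.W_zero, h.Z_zero]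
  have hVZ : V * V + Z * Z = (Fintype.card G : AddMonoidAlgebra ℤ G) - J := by
    linear_combination h.norm_row - h.U_sq
  have hsq : (J - 2 * blockSum (D 0)) * (J - 2 * blockSum (D 0)) +
      (J - 2 * blockSum (D 1)) * (J - 2 * blockSum (D 1)) +
      (J - 2 * blockSum (D 2)) * (J - 2 * blockSum (D 2)) +
      (J - 2 * blockSum (D 3)) * (J - 2 * blockSum (D 3)) =
        4 * (Fintype.card G : AddMonoidAlgebra ℤ G) := by
    rw [← e0, ← e1, ← e2, ← e3]
    linear_combination 4 * h.norm_row - 2 * h.U_sq + 2 * h.W_sq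
  have h02 : (J - 2 * blockSum (D 0)) * (J - 2 * blockSum (D 2)) = J := by
    rw [← e0, ← e2]; linear_combination h.U_sq
  have h13 : (J - 2 * blockSum (D 1)) * (J - 2 * blockSum (D 3)) = J := by
    rw [← e1, ← e3]; linear_combination h.W_sq
  refine ⟨D, ?_, fun i => (hneg i).symm, hzero, ?_, ?_, ?_, ?_⟩
  · refine isDifferenceFamily_of_coeff hsymm fun g hg => ?_
    -- The relation `hsq` is four times the claim, hence two cancellations.
    have key : ∑ i, blockSum (D i) * blockSum (D i) = (Fintype.card G : AddMonoidAlgebra ℤ G) +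
        (∑ i, ((D i).card : ℤ) - (Fintype.card G : ℤ)) • J := by
      apply eq_of_two_mul_eq
      apply eq_of_two_mul_eq
      simp only [Fin.sum_univ_four, zsmul_eq_mul]
      push_cast
      linear_combination hsq - 4 * hJJ + 4 * hk 0 + 4 * hk 1 + 4 * hk 2 + 4 * hk 3
    rw [key, coeff_add, Finsupp.add_apply, coeff_natCast_apply, if_neg hg, coeff_smul_apply, hJ,
      coeff_blockSum_univ]
    simp
  · have hE0 := two_mul_blockSum_star (fun x hx => (unitE x hx).1)
      (by simp [h.V_zero, h.Z_zero])
    have hE1 := two_mul_blockSum_star (fun x hx => (unitE x hx).2)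
      (by simp [h.V_zero, h.Z_zero])
    have z0 : (0 : G) ∉ minusBlock (V + Z) := by simp [mem_minusBlock, h.V_zero, h.Z_zero]
    have z1 : (0 : G) ∉ minusBlock (V - Z) := by simp [mem_minusBlock, h.V_zero, h.Z_zero]
    refine ⟨minusBlock (V + Z), minusBlock (V - Z), z0, z1, ?_, ?_, ?_⟩
    · apply eq_of_two_mul_eq
      linear_combination e0 + e1 - e2 - e3 - hE0.1 + hE0.2
    · apply eq_of_two_mul_eq
      linear_combination e0 - e1 - e2 + e3 - hE1.1 + hE1.2
    · refine isDifferenceFamily_of_coeff ?_ fun g hg => ?_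
      · have s0 := minusBlock_neg_mem (A := V + Z) fun y => by simp [h.V_neg, h.Z_neg]
        have s1 := minusBlock_neg_mem (A := V - Z) fun y => by simp [h.V_neg, h.Z_neg]
        intro i x
        fin_cases i <;> simp [starCompl, s0, s1]
      · have key : ∑ i, blockSum (![minusBlock (V + Z), minusBlock (V - Z),
            starCompl (minusBlock (V + Z)), starCompl (minusBlock (V - Z))] i) *
            blockSum (![minusBlock (V + Z), minusBlock (V - Z),
            starCompl (minusBlock (V + Z)), starCompl (minusBlock (V - Z))] i) =
            (Fintype.card G : AddMonoidAlgebra ℤ G) + 1 +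
              ((Fintype.card G : ℤ) - 3) • J := by
          apply eq_of_two_mul_eq
          apply eq_of_two_mul_eq
          obtain ⟨f0, f0'⟩ := hE0
          obtain ⟨f1, f1'⟩ := hE1
          simp only [Fin.sum_univ_four, zsmul_eq_mul, Matrix.cons_val]
          push_cast
          generalize blockSum (minusBlock (V + Z)) = x0 at *
          generalize blockSum (minusBlock (V - Z)) = x1 at *
          generalize blockSum (starCompl (minusBlock (V + Z))) = x2 at *
          generalize blockSum (starCompl (minusBlock (V - Z))) = x3 at *
          rw [← hJ] at f0 f0' f1 f1'
          linear_combination (2 * x0 + (J - 1 - (V + Z))) * f0 + (2 * x1 + (J - 1 - (V - Z))) * f1 +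
            (2 * x2 + (J - 1 + (V + Z))) * f0' + (2 * x3 + (J - 1 + (V - Z))) * f1' +
            4 * hVZ + 4 * hJJ
        have c0 := card_add_card_starCompl z0
        have c1 := card_add_card_starCompl z1
        rw [key, coeff_add, coeff_add, Finsupp.add_apply, Finsupp.add_apply, coeff_natCast_apply,
          if_neg hg, one_def, coeff_single, Finsupp.single_apply, if_neg (Ne.symm hg),
          coeff_smul_apply, hJ, coeff_blockSum_univ]
        simp only [Fin.sum_univ_four, Matrix.cons_val, smul_eq_mul]
        linarith
  · unfold CondD3
    rw [hneg, hneg, hneg, hneg]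
    apply eq_of_two_mul_eq
    simp only [Fin.sum_univ_four, zsmul_eq_mul]
    push_cast
    linear_combination h02 + h13 - 2 * hJJ + 2 * hk 0 + 2 * hk 1 + 2 * hk 2 + 2 * hk 3
  · have hsum : ∑ i, blockSum (D i) = 2 * J - U - W := by
      apply eq_of_two_mul_eq
      rw [Fin.sum_univ_four]
      linear_combination e0 + e1 + e2 + e3
    have hsum' : ∀ x, (∑ i, blockSum (D i)).coeff x = 2 - U.coeff x - W.coeff x := by
      intro x
      rw [hsum, two_mul]
      simp [hJ, coeff_blockSum_univ]
    refine ⟨fun x hx => ?_, ?_, ?_⟩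
    · rw [hsum']
      rcases h.row x hx with ⟨u1, -, -, u4⟩ | ⟨u1, -, -, u4⟩
      · rcases Int.isUnit_iff.1 u1 with u | u <;> simp [u, u4]
      · rcases Int.isUnit_iff.1 u4 with u | u <;> simp [u, u1]
    · rw [hsum', h.U_zero, h.W_zero]; simp
    · rintro ⟨j, hj, -⟩
      have hc : ∀ i, (blockSum (D i)).coeff 0 = 0 := fun i => by
        rw [coeff_blockSum, if_neg (hzero i)]
      fin_cases j <;> simp [hc] at hj
  · -- Both `V` and `Z` have coefficient sum zero: the squares of these sums add up to `n - n`.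
    have hs : (∑ x, V.coeff x) * (∑ x, V.coeff x) + (∑ x, Z.coeff x) * (∑ x, Z.coeff x) = 0 := by
      rw [← sum_coeff_mul, ← sum_coeff_mul, ← Finset.sum_add_distrib]
      have : ∀ x, (V * V).coeff x + (Z * Z).coeff x =
          (if x = 0 then (Fintype.card G : ℤ) else 0) - 1 := by
        intro x
        rw [← Finsupp.add_apply, ← coeff_add, hVZ, coeff_sub, Finsupp.sub_apply,
          coeff_natCast_apply, hJ, coeff_blockSum_univ]
      simp [this]
    have hv : ∑ x, V.coeff x = 0 := by nlinarith
    have hz : ∑ x, Z.coeff x = 0 := by nlinarith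
    have hd : blockSum (D 0) + blockSum (D 3) + V - Z = blockSum (D 1) + blockSum (D 2) := by
      apply eq_of_two_mul_eq
      linear_combination e0 - e1 - e2 + e3
    have := congrArg (fun c : AddMonoidAlgebra ℤ G => ∑ x, c.coeff x) hd
    simp only [coeff_add, coeff_sub, Finsupp.add_apply, Finsupp.sub_apply, Finset.sum_add_distrib,
      Finset.sum_sub_distrib, sum_coeff_blockSum, hv, hz] at this
    unfold CondD5
    omega

end Conclusion

/-! ### The group `ℤ₃²` and finite products -/

/-- The four lines through `0` in `ZMod 3 × ZMod 3`, split into two pairs: `U` and `V` are built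
from the two axes, `W` and `Z` from the two diagonals. -/
lemma hasRowQuadruple_zmod_three_sq : HasRowQuadruple (ZMod 3 × ZMod 3) := by
  refine ⟨ofFun fun x => -1 + (if x.1 = 0 then 1 else 0) + (if x.2 = 0 then 1 else 0),
    ofFun fun x => (if x.1 = 0 then 1 else 0) - (if x.2 = 0 then 1 else 0),
    ofFun fun x => -1 + (if x.1 = x.2 then 1 else 0) + (if x.1 = -x.2 then 1 else 0),
    ofFun fun x => (if x.1 = x.2 then 1 else 0) - (if x.1 = -x.2 then 1 else 0), ?_⟩
  constructor
  case U_mul_Z | V_mul_W | U_sq | W_sq | norm_row =>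
    ext x
    simp only [coeff_add, Finsupp.add_apply, coeff_mul_eq_sum, coeff_ofFun, coeff_blockSum_univ,
      coeff_natCast_apply, coeff_zero, Finsupp.zero_apply]
    revert x
    decide
  all_goals
    simp only [coeff_ofFun, Int.isUnit_iff]
    decide

lemma hasRowQuadruple_fin_two_zmod_three : HasRowQuadruple (Fin 2 → ZMod 3) :=
  hasRowQuadruple_zmod_three_sq.of_addEquiv
    (LinearEquiv.finTwoArrow (ZMod 3) (ZMod 3)).symm.toAddEquiv

lemma hasRowQuadruple_fin_four_mul {p : ℕ} [Fact p.Prime]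
    (h : HasRowQuadruple (Fin 4 → ZMod p)) (t : ℕ) : HasRowQuadruple (Fin (4 * t) → ZMod p) := by
  induction t with
  | zero =>
    have : IsEmpty (Fin (4 * 0)) := Fin.isEmpty
    exact hasRowQuadruple_of_subsingleton _
  | succ t ih =>
    exact (h.prod ih).of_addEquiv
      (LinearEquiv.ofFinrankEq (R := ZMod p) _ _ (by simp; ring)).toAddEquiv

/-- Splitting off the first factor of a finite product of groups. -/
def consAddEquiv {s : ℕ} (M : Fin (s + 1) → Type) [∀ i, AddCommGroup (M i)] :
    M 0 × (∀ i : Fin s, M i.succ) ≃+ ∀ i, M i :=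
  { Fin.consEquiv M with
    map_add' := fun x y => by
      funext i
      refine Fin.cases ?_ (fun j => ?_) i <;> simp [Fin.consEquiv] }

lemma hasRowQuadruple_pi {s : ℕ} (M : Fin s → Type) [∀ i, AddCommGroup (M i)]
    [∀ i, Fintype (M i)] (h : ∀ i, HasRowQuadruple (M i)) : HasRowQuadruple (∀ i, M i) := by
  induction s with
  | zero => exact hasRowQuadruple_of_subsingleton _
  | succ s ih =>
    exact ((h 0).prod (ih (fun i => M i.succ) fun i => h i.succ)).of_addEquiv (consAddEquiv M)

/-! ### Lines in the plane over a finite field -/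

section Plane

variable {F : Type} [Field F] [Fintype F] [DecidableEq F]

/-- The determinant form on `F × F`. -/
def detForm (u v : F × F) : F := u.1 * v.2 - u.2 * v.1

/-- Functions on the plane that transform by the quadratic character under scaling. -/
def IsQuadHomogeneous (f : F × F → ℤ) : Prop :=
  ∀ (a : F) (v : F × F), f (a • v) = quadraticChar F a * f v

/-- The sum of `f` over the affine line `detForm v u = 1`. On functions that are homogeneous in the
sense of `IsQuadHomogeneous` this operator is the Paley conference matrix indexed by the lines
through the origin. -/
def lineSum (f : F × F → ℤ) (u : F × F) : ℤ := ∑ v, if detForm v u = 1 then f v else 0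

/-- A generator of each line through the origin; the lines are indexed by their slopes. -/
def lineRep : Option F → F × F
  | none => (1, 0)
  | some z => (z, 1)

/-- The index of the line spanned by a nonzero vector. -/
def slopeIndex (v : F × F) : Option F := if v.2 = 0 then none else some (v.1 / v.2)

/-- The element of `ℤ[F × F]` attached to a line through the origin. -/
noncomputable def lineElt (i : Option F) : AddMonoidAlgebra ℤ (F × F) :=
  ∑ a : F, single (a • lineRep i) 1

omit [Fintype F] in
lemma detForm_lineRep_eq_zero_iff {v : F × F} (hv : v ≠ 0) (i : Option F) :
    detForm (lineRep i) v = 0 ↔ i = slopeIndex v := by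
  obtain ⟨x, y⟩ := v
  cases i with
  | none => by_cases hy : y = 0 <;> simp [detForm, lineRep, slopeIndex, hy]
  | some z =>
    by_cases hy : y = 0
    · subst hy
      have hx : x ≠ 0 := fun h => hv (by simp [h])
      simp [detForm, lineRep, slopeIndex, hx]
    · simp [detForm, lineRep, slopeIndex, hy, sub_eq_zero, eq_div_iff]

omit [Fintype F] in
lemma exists_smul_lineRep {v : F × F} (hv : v ≠ 0) :
    ∃ a : F, a ≠ 0 ∧ v = a • lineRep (slopeIndex v) := by
  obtain ⟨x, y⟩ := v
  by_cases hy : y = 0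
  · subst hy
    have hx : x ≠ 0 := fun h => hv (by simp [h])
    exact ⟨x, hx, by simp [slopeIndex, lineRep]⟩
  · exact ⟨y, hy, by simp [slopeIndex, lineRep, hy, mul_div_cancel₀]⟩

lemma coeff_lineElt (i : Option F) (v : F × F) :
    (lineElt i).coeff v = if detForm (lineRep i) v = 0 then 1 else 0 := by
  obtain ⟨x, y⟩ := v
  simp only [lineElt, coeff_sum, Finsupp.finsetSum_apply, coeff_single, Finsupp.single_apply]
  cases i with
  | none =>
    by_cases hy : y = 0
    · simp [detForm, lineRep, hy]
    · simp [detForm, lineRep, hy, eq_comm (a := (0 : F))]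
  | some z =>
    simp only [detForm, lineRep, Prod.smul_mk, smul_eq_mul, mul_one, Prod.mk.injEq, one_mul]
    rw [Finset.sum_eq_single y]
    · simp [sub_eq_zero, mul_comm]
    · intro b _ hb; simp [hb]
    · simp

omit [DecidableEq F] in
lemma lineElt_mul_self (i : Option F) : lineElt i * lineElt i = Fintype.card F • lineElt i := by
  have : ∀ a : F, ∑ b : F, (single (a • lineRep i) 1 * single (b • lineRep i) 1 :
      AddMonoidAlgebra ℤ (F × F)) = lineElt i := by
    intro a
    simp only [single_mul_single, ← add_smul, mul_one]
    exact Equiv.sum_comp (Equiv.addLeft a)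
      (fun b => (single (b • lineRep i) 1 : AddMonoidAlgebra ℤ (F × F)))
  conv_lhs => rw [lineElt, Finset.sum_mul_sum]
  rw [Finset.sum_congr rfl fun a _ => this a, Finset.sum_const, Finset.card_univ]

lemma lineElt_mul_of_ne {i j : Option F} (hij : i ≠ j) :
    lineElt i * lineElt j = blockSum Finset.univ := by
  have hdet : detForm (lineRep i) (lineRep j) ≠ 0 := by
    rw [Ne, detForm_lineRep_eq_zero_iff (by cases j <;> simp [lineRep, Prod.ext_iff])]
    cases j <;> simpa [slopeIndex, lineRep] using hij
  have hinj : Function.Injective fun c : F × F => c.1 • lineRep i + c.2 • lineRep j := by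
    rintro ⟨a, b⟩ ⟨a', b'⟩ h
    simp only [Prod.ext_iff, Prod.fst_add, Prod.snd_add, Prod.smul_fst, Prod.smul_snd,
      smul_eq_mul] at h
    obtain ⟨h1, h2⟩ := h
    have ha : (a - a') * detForm (lineRep i) (lineRep j) = 0 := by
      simp only [detForm]
      linear_combination (lineRep j).2 * h1 - (lineRep j).1 * h2
    have hb : (b - b') * detForm (lineRep i) (lineRep j) = 0 := by
      simp only [detForm]
      linear_combination (lineRep i).1 * h2 - (lineRep i).2 * h1
    rw [Prod.mk.injEq]
    exact ⟨sub_eq_zero.1 ((mul_eq_zero.1 ha).resolve_right hdet),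
      sub_eq_zero.1 ((mul_eq_zero.1 hb).resolve_right hdet)⟩
  have hbij := Finite.injective_iff_bijective.1 hinj
  rw [lineElt, lineElt, Finset.sum_mul_sum, ← Fintype.sum_prod_type', blockSum]
  simp only [single_mul_single, mul_one]
  exact hbij.sum_comp fun x => (single x 1 : AddMonoidAlgebra ℤ (F × F))

/-- The lines through the origin partition the nonzero vectors. -/
lemma sum_lineElt : ∑ i : Option F, lineElt i =
    blockSum Finset.univ + (Fintype.card F : AddMonoidAlgebra ℤ (F × F)) := by
  ext v
  rw [coeff_sum, Finsupp.finsetSum_apply, coeff_add, Finsupp.add_apply, coeff_blockSum_univ,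
    coeff_natCast_apply]
  simp only [coeff_lineElt]
  by_cases hv : v = 0
  · subst hv; simp [detForm, add_comm]
  · simp [detForm_lineRep_eq_zero_iff hv, hv]

omit [DecidableEq F] in
lemma sum_sum_smul_lineRep (g : F × F → ℤ) :
    ∑ i : Option F, ∑ a : F, g (a • lineRep i) = ∑ v, g v + Fintype.card F * g 0 := by
  classical
  have h1 : ∀ a : F, ∑ z : F, g (a * z, a) =
      ∑ x : F, g (x, a) + if a = 0 then Fintype.card F * g 0 - ∑ x : F, g (x, 0) else 0 := by
    intro a
    by_cases ha : a = 0
    · subst ha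
      have : ((0 : F), (0 : F)) = 0 := rfl
      simp [this]
    · simp only [ha, if_false, add_zero]
      exact Equiv.sum_comp (Equiv.mulLeft₀ a ha) fun x => g (x, a)
  rw [Fintype.sum_option, Fintype.sum_prod_type_right g]
  simp only [lineRep, Prod.smul_mk, smul_eq_mul, mul_one, mul_zero]
  rw [Finset.sum_comm, Finset.sum_congr rfl fun a _ => h1 a, Finset.sum_add_distrib,
    Finset.sum_ite_eq' Finset.univ (0 : F)]
  simp only [Finset.mem_univ, if_true]
  ring

omit [Fintype F] [DecidableEq F] in
lemma detForm_smul_left (a : F) (u v : F × F) : detForm (a • u) v = a * detForm u v := by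
  simp [detForm]; ring

omit [Fintype F] [DecidableEq F] in
lemma detForm_swap (u v : F × F) : detForm u v = -detForm v u := by
  simp [detForm]; ring

omit [Fintype F] [DecidableEq F] in
lemma detForm_sub_right (u v w : F × F) : detForm u (v - w) = detForm u v - detForm u w := by
  simp [detForm]; ring

omit [DecidableEq F] in
lemma sum_smul_eq {a : F} (ha : a ≠ 0) (g : F × F → ℤ) : ∑ v, g (a • v) = ∑ v, g v :=
  Equiv.sum_comp (MulAction.toPerm (Units.mk0 a ha)) g

lemma quadraticChar_mul_self {a : F} (ha : a ≠ 0) :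
    quadraticChar F a * quadraticChar F a = 1 := by
  rw [← sq, quadraticChar_sq_one ha]

lemma IsQuadHomogeneous.zero {f : F × F → ℤ} (hf : IsQuadHomogeneous f) : f 0 = 0 := by
  simpa using hf 0 0

/-- Scaling determines the sums over all affine lines from `lineSum`; over a line through the
origin the sum vanishes, since scaling by a nonsquare changes its sign. -/
lemma sum_detForm_eq (hF : ringChar F ≠ 2) {f : F × F → ℤ} (hf : IsQuadHomogeneous f)
    (u : F × F) (t : F) :
    (∑ v, if detForm v u = t then f v else 0) = quadraticChar F t * lineSum f u := by
  by_cases ht : t = 0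
  · subst ht
    obtain ⟨a, ha⟩ := quadraticChar_exists_neg_one hF
    have ha0 : a ≠ 0 := by rintro rfl; simp at ha
    have := sum_smul_eq ha0 fun v => if detForm v u = 0 then f v else 0
    simp only [detForm_smul_left, mul_eq_zero, ha0, false_or, hf a, ha] at this
    have h2 : ∀ v, (if detForm v u = 0 then -1 * f v else 0) =
        -(if detForm v u = 0 then f v else 0) := fun v => by split_ifs <;> simp
    simp only [h2, Finset.sum_neg_distrib] at this
    simp only [MulChar.map_zero, zero_mul]
    omega
  · rw [← sum_smul_eq ht, lineSum, Finset.mul_sum]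
    refine Finset.sum_congr rfl fun v _ => ?_
    rw [detForm_smul_left, hf t, mul_ite, mul_zero]
    simp [ht]

lemma coeff_ofFun_mul_lineElt (hF : ringChar F ≠ 2) {f : F × F → ℤ} (hf : IsQuadHomogeneous f)
    (i : Option F) (x : F × F) :
    (ofFun f * lineElt i).coeff x =
      quadraticChar F (detForm x (lineRep i)) * lineSum f (lineRep i) := by
  rw [← sum_detForm_eq hF hf, coeff_mul_eq_sum]
  refine Finset.sum_congr rfl fun y _ => ?_
  rw [coeff_lineElt, coeff_ofFun, detForm_sub_right, detForm_swap _ x, detForm_swap _ y]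
  simp only [mul_ite, mul_one, mul_zero]
  congr 1
  rw [eq_iff_iff]
  constructor <;> intro h <;> linear_combination h

lemma sum_sq_mul_quadraticChar (hF : ringChar F ≠ 2) (hneg : quadraticChar F (-1) = 1) (b : F) :
    ∑ a : F, quadraticChar F a * quadraticChar F a * quadraticChar F (a * b - 1) =
      Fintype.card F * (if b = 0 then 1 else 0) - 1 := by
  have h1 : ∀ a : F, quadraticChar F a * quadraticChar F a * quadraticChar F (a * b - 1) =
      quadraticChar F (a * b - 1) - if a = 0 then 1 else 0 := by
    intro a
    by_cases ha : a = 0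
    · subst ha; simp [hneg]
    · rw [quadraticChar_mul_self ha, one_mul, if_neg ha, sub_zero]
  simp only [h1, Finset.sum_sub_distrib, Finset.sum_ite_eq', Finset.mem_univ, if_true]
  congr 1
  by_cases hb : b = 0
  · subst hb; simp [hneg]
  · simp only [hb, if_false, mul_zero]
    rw [← quadraticChar_sum_zero hF]
    exact Equiv.sum_comp ((Equiv.mulRight₀ b hb).trans (Equiv.subRight 1)) (quadraticChar F)

/-- The convolution square of a homogeneous function `Z` that is, up to the scalar `c`, the
transform of a homogeneous function `V` whose transform is `c Z`. Writing one factor of `Z * Z` as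
a sum of values of `V` over lines turns the other one into `V` again. -/
lemma ofFun_mul_self_eq_sum_lineElt (hF : ringChar F ≠ 2) (hneg : quadraticChar F (-1) = 1)
    {V Z : F × F → ℤ} (hV : IsQuadHomogeneous V) (hZ : IsQuadHomogeneous Z) {c : ℤ} (hc : c ≠ 0)
    (hVZ : ∀ u, lineSum V u = c * Z u) (hZV : ∀ u, lineSum Z u = c * V u) :
    ofFun Z * ofFun Z = ∑ i : Option F, (V (lineRep i) * V (lineRep i)) •
      (Fintype.card F • lineElt i - blockSum Finset.univ) := by
  ext x
  have h1 : (ofFun Z * ofFun Z).coeff x =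
      ∑ v, V v * V v * quadraticChar F (detForm v x - 1) := by
    rw [coeff_mul_eq_sum]
    simp only [coeff_ofFun]
    apply mul_left_cancel₀ hc
    calc c * ∑ y, Z y * Z (x - y) = ∑ y, lineSum V y * Z (x - y) := by
          rw [Finset.mul_sum]
          exact Finset.sum_congr rfl fun y _ => by rw [hVZ]; ring
      _ = ∑ v, V v * ∑ y, if detForm v y = 1 then Z (x - y) else 0 := by
          simp only [lineSum, Finset.sum_mul, Finset.mul_sum]
          rw [Finset.sum_comm]
          refine Finset.sum_congr rfl fun v _ => Finset.sum_congr rfl fun y _ => ?_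
          split_ifs <;> simp
      _ = ∑ v, V v * (quadraticChar F (detForm v x - 1) * (c * V v)) := by
          refine Finset.sum_congr rfl fun v _ => ?_
          congr 1
          have e1 : quadraticChar F (detForm v x - 1) = quadraticChar F (-(detForm v x - 1)) := by
            rw [← neg_one_mul (detForm v x - 1), map_mul, hneg, one_mul]
          rw [← hZV, e1, ← sum_detForm_eq hF hZ, ← Equiv.sum_comp (Equiv.subLeft x)]
          refine Finset.sum_congr rfl fun y _ => ?_
          simp only [Equiv.subLeft_apply, sub_sub_cancel]
          congr 1
          rw [detForm_sub_right, detForm_swap y v, eq_iff_iff]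
          constructor <;> intro h <;> linear_combination h
      _ = c * ∑ v, V v * V v * quadraticChar F (detForm v x - 1) := by
          rw [Finset.mul_sum]
          exact Finset.sum_congr rfl fun v _ => by ring
  have h2 := sum_sum_smul_lineRep fun v => V v * V v * quadraticChar F (detForm v x - 1)
  rw [hV.zero, zero_mul, zero_mul, mul_zero, add_zero] at h2
  rw [h1, ← h2, coeff_sum, Finsupp.finsetSum_apply]
  refine Finset.sum_congr rfl fun i _ => ?_
  rw [coeff_smul_apply, coeff_sub, Finsupp.sub_apply, coeff_smul_apply, coeff_blockSum_univ,
    coeff_lineElt, nsmul_eq_mul, ← sum_sq_mul_quadraticChar hF hneg, smul_eq_mul, Finset.mul_sum]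
  refine Finset.sum_congr rfl fun a _ => ?_
  rw [hV a, detForm_smul_left]
  ring

end Plane

/-! ### Quadruples from functions exchanged by `lineSum` -/

/-- Signs on a finite set of odd cardinality can be chosen with sum one. -/
lemma exists_signs_sum_eq_one {ι : Type*} [Fintype ι] [DecidableEq ι] {I : Finset ι}
    (hI : Odd I.card) :
    ∃ ε : ι → ℤ, (∀ i ∈ I, IsUnit (ε i)) ∧ (∀ i ∉ I, ε i = 0) ∧ ∑ i, ε i = 1 := by
  obtain ⟨k, hk⟩ := hI
  obtain ⟨S, hS, hSk⟩ := Finset.exists_subset_card_eq (s := I) (n := k + 1) (by omega)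
  -- The sign is `1` on the subset `S` of `k + 1` points and `-1` on the other `k` points of `I`.
  refine ⟨fun i => 2 * (if i ∈ S then 1 else 0) - if i ∈ I then 1 else 0, fun i hi => ?_,
    fun i hi => ?_, ?_⟩
  · by_cases h : i ∈ S <;> simp [h, hi]
  · have : i ∉ S := fun h => hi (hS h)
    simp [hi, this]
  · simp only [Finset.sum_sub_distrib, ← Finset.mul_sum, Finset.sum_ite_mem, Finset.univ_inter,
      Finset.sum_const, hSk, hk, nsmul_eq_mul]
    push_cast
    ring

section Plane

variable {F : Type} [Field F] [Fintype F] [DecidableEq F]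

/-- Two homogeneous functions with values `0, ±1` that are supported on complementary sets of lines
through the origin, and that `lineSum` exchanges up to the nonzero scalar `c`. -/
structure IsLineSumPair (V Z : F × F → ℤ) (c : ℤ) : Prop where
  left_hom : IsQuadHomogeneous V
  right_hom : IsQuadHomogeneous Z
  ne_zero : c ≠ 0
  lineSum_left : ∀ u, lineSum V u = c * Z u
  lineSum_right : ∀ u, lineSum Z u = c * V u
  support : ∀ v, v ≠ 0 → (IsUnit (V v) ∧ Z v = 0) ∨ (V v = 0 ∧ IsUnit (Z v))

lemma IsLineSumPair.swap {V Z : F × F → ℤ} {c : ℤ} (h : IsLineSumPair V Z c) :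
    IsLineSumPair Z V c :=
  ⟨h.right_hom, h.left_hom, h.ne_zero, h.lineSum_right, h.lineSum_left,
    fun v hv => (h.support v hv).symm.imp And.symm And.symm⟩

omit [Fintype F] [DecidableEq F] in
lemma lineRep_ne_zero (i : Option F) : lineRep i ≠ 0 := by
  cases i <;> simp [lineRep, Prod.ext_iff]

lemma IsLineSumPair.mul_self_add_mul_self {V Z : F × F → ℤ} {c : ℤ} (h : IsLineSumPair V Z c)
    {v : F × F} (hv : v ≠ 0) : V v * V v + Z v * Z v = 1 := by
  rcases h.support v hv with ⟨h1, h2⟩ | ⟨h1, h2⟩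
  · rw [h2, Int.isUnit_mul_self h1]; rfl
  · rw [h1, Int.isUnit_mul_self h2]; rfl

/-- The two supports contain equally many lines: compare the coefficients at `0` in
`ofFun_mul_self_eq_sum_lineElt`. -/
lemma IsLineSumPair.sum_sq_eq (hF : ringChar F ≠ 2) (hneg : quadraticChar F (-1) = 1)
    {V Z : F × F → ℤ} {c : ℤ} (h : IsLineSumPair V Z c) :
    ∑ i : Option F, V (lineRep i) * V (lineRep i) =
      ∑ i : Option F, Z (lineRep i) * Z (lineRep i) := by
  have key := congrArg (fun a : AddMonoidAlgebra ℤ (F × F) => a.coeff 0)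
    (ofFun_mul_self_eq_sum_lineElt hF hneg h.left_hom h.right_hom h.ne_zero h.lineSum_left
      h.lineSum_right)
  simp only [coeff_mul_eq_sum, coeff_ofFun, coeff_sum, Finsupp.finsetSum_apply, coeff_smul_apply,
    coeff_sub, Finsupp.sub_apply, coeff_blockSum_univ, coeff_lineElt] at key
  have h1 : ∀ y, Z y * Z (0 - y) = Z y * Z y := by
    intro y
    have := h.right_hom (-1) y
    rw [hneg, neg_one_smul, one_mul] at this
    rw [zero_sub, this]
  have h2 := sum_sum_smul_lineRep fun v => Z v * Z v
  rw [h.right_hom.zero, zero_mul, mul_zero, add_zero] at h2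
  have h3 : ∀ i : Option F, ∑ a : F, Z (a • lineRep i) * Z (a • lineRep i) =
      Z (lineRep i) * Z (lineRep i) * (Fintype.card F - 1) := by
    intro i
    have := sum_sq_mul_quadraticChar hF hneg 0
    simp only [mul_zero, zero_sub, hneg, mul_one, if_true] at this
    rw [← this, Finset.mul_sum]
    exact Finset.sum_congr rfl fun a _ => by rw [h.right_hom a]; ring
  have h4 : ∀ i : Option F, detForm (lineRep i) 0 = 0 := fun i => by simp [detForm]
  simp only [h1, ← h2, h3, h4, if_true, nsmul_eq_mul, mul_one, smul_eq_mul, ← Finset.sum_mul] at key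
  have hcard : (Fintype.card F : ℤ) - 1 ≠ 0 := by
    have := Fintype.one_lt_card (α := F)
    omega
  exact (mul_right_cancel₀ hcard key).symm

/-- The two supports partition the `|F| + 1` lines into halves, and `|F| + 1` is `2` modulo `4`. -/
lemma IsLineSumPair.odd_card (hF : ringChar F ≠ 2) (hcard : Fintype.card F % 4 = 1)
    (hneg : quadraticChar F (-1) = 1) {V Z : F × F → ℤ} {c : ℤ} (h : IsLineSumPair V Z c) :
    Odd (Finset.univ.filter fun i : Option F => V (lineRep i) ≠ 0).card := by
  have h1 : ∑ i : Option F, V (lineRep i) * V (lineRep i) =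
      ((Finset.univ.filter fun i : Option F => V (lineRep i) ≠ 0).card : ℤ) := by
    rw [Finset.card_filter]
    push_cast
    refine Finset.sum_congr rfl fun i _ => ?_
    rcases h.support _ (lineRep_ne_zero i) with ⟨hi, -⟩ | ⟨hi, -⟩
    · simp [Int.isUnit_mul_self hi, hi.ne_zero]
    · simp [hi]
  have h2 : ∑ i : Option F, (V (lineRep i) * V (lineRep i) + Z (lineRep i) * Z (lineRep i)) =
      Fintype.card F + 1 := by
    rw [Finset.sum_congr rfl fun i _ => h.mul_self_add_mul_self (lineRep_ne_zero i)]
    simp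
  rw [Finset.sum_add_distrib, ← h.sum_sq_eq hF hneg, h1] at h2
  rw [Nat.odd_iff]
  omega

/-- A signed sum `W` of the lines supporting `V`, the signs adding up to one. The lines in the
support of `V` annihilate `V`, and `W * W` only depends on the support. -/
lemma IsLineSumPair.exists_signed_lines (hF : ringChar F ≠ 2) (hcard : Fintype.card F % 4 = 1)
    (hneg : quadraticChar F (-1) = 1) {V Z : F × F → ℤ} {c : ℤ} (h : IsLineSumPair V Z c) :
    ∃ W : AddMonoidAlgebra ℤ (F × F), (∀ x, W.coeff (-x) = W.coeff x) ∧ W.coeff 0 = 1 ∧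
      (∀ x, x ≠ 0 → IsUnit (V x) → IsUnit (W.coeff x)) ∧
      (∀ x, x ≠ 0 → V x = 0 → W.coeff x = 0) ∧
      ofFun V * W = 0 ∧ W * W = ofFun Z * ofFun Z + blockSum Finset.univ := by
  obtain ⟨ε, hε1, hε0, hεs⟩ := exists_signs_sum_eq_one (h.odd_card hF hcard hneg)
  simp only [Finset.mem_filter, Finset.mem_univ, true_and, not_not] at hε1 hε0
  have hcoeff : ∀ x, (∑ i, ε i • lineElt i).coeff x =
      ∑ i, ε i * if detForm (lineRep i) x = 0 then 1 else 0 := by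
    intro x
    simp only [coeff_sum, Finsupp.finsetSum_apply, coeff_smul_apply, coeff_lineElt, smul_eq_mul]
  have hslope : ∀ x, x ≠ 0 → (∑ i, ε i • lineElt i).coeff x = ε (slopeIndex x) := by
    intro x hx
    rw [hcoeff]
    simp [detForm_lineRep_eq_zero_iff hx]
  refine ⟨∑ i, ε i • lineElt i, fun x => ?_, ?_, fun x hx hV => ?_, fun x hx hV => ?_, ?_, ?_⟩
  · simp only [hcoeff]
    refine Finset.sum_congr rfl fun i _ => ?_
    have : detForm (lineRep i) (-x) = -detForm (lineRep i) x := by simp [detForm]; ring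
    simp only [this, neg_eq_zero]
  · rw [hcoeff]
    exact (Finset.sum_congr rfl fun i _ => by simp [detForm]).trans hεs
  · rw [hslope x hx]
    obtain ⟨a, ha, hax⟩ := exists_smul_lineRep hx
    apply hε1
    rw [hax, h.left_hom a] at hV
    exact right_ne_zero_of_mul hV.ne_zero
  · rw [hslope x hx]
    obtain ⟨a, ha, hax⟩ := exists_smul_lineRep hx
    apply hε0
    rw [hax, h.left_hom a, mul_eq_zero, quadraticChar_eq_zero_iff] at hV
    exact hV.resolve_left ha
  · rw [Finset.mul_sum]
    refine Finset.sum_eq_zero fun i _ => ?_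
    rw [mul_smul_comm]
    by_cases hi : V (lineRep i) = 0
    · rw [hε0 i hi, zero_smul]
    · have hZ : Z (lineRep i) = 0 :=
        ((h.support _ (lineRep_ne_zero i)).resolve_right fun h' => hi h'.1).2
      have : ofFun V * lineElt i = 0 := by
        ext x
        rw [coeff_ofFun_mul_lineElt hF h.left_hom, h.lineSum_left, hZ]
        simp
      rw [this, smul_zero]
  · have hmul : ∀ i j : Option F, lineElt i * lineElt j = blockSum Finset.univ +
        if i = j then Fintype.card F • lineElt i - blockSum Finset.univ else 0 := by
      intro i j
      by_cases hij : i = j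
      · subst hij; rw [lineElt_mul_self]; simp
      · rw [lineElt_mul_of_ne hij]; simp [hij]
    have hsq : ∀ i, ε i * ε i = V (lineRep i) * V (lineRep i) := by
      intro i
      rcases h.support _ (lineRep_ne_zero i) with ⟨hi, -⟩ | ⟨hi, -⟩
      · rw [Int.isUnit_mul_self hi, Int.isUnit_mul_self (hε1 i hi.ne_zero)]
      · rw [hi, hε0 i hi]
    rw [ofFun_mul_self_eq_sum_lineElt hF hneg h.left_hom h.right_hom h.ne_zero h.lineSum_left
      h.lineSum_right, Finset.sum_mul_sum]
    simp only [smul_mul_smul_comm, hmul, smul_add, smul_ite, smul_zero, Finset.sum_add_distrib,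
      Finset.sum_ite_eq, Finset.mem_univ, if_true, hsq]
    rw [add_comm]
    congr 1
    simp only [← Finset.sum_smul, ← Finset.mul_sum, hεs, mul_one, one_smul]

/-- Here `W` and `U` are signed sums of the lines supporting `V` and `Z`. -/
theorem IsLineSumPair.hasRowQuadruple (hF : ringChar F ≠ 2) (hcard : Fintype.card F % 4 = 1)
    (hneg : quadraticChar F (-1) = 1) {V Z : F × F → ℤ} {c : ℤ} (h : IsLineSumPair V Z c) :
    HasRowQuadruple (F × F) := by
  obtain ⟨W, W_neg, W_zero, W_unit, W_off, VW, WW⟩ := h.exists_signed_lines hF hcard hneg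
  obtain ⟨U, U_neg, U_zero, U_unit, U_off, ZU, UU⟩ := h.swap.exists_signed_lines hF hcard hneg
  have even : ∀ {f : F × F → ℤ}, IsQuadHomogeneous f → ∀ x, f (-x) = f x := by
    intro f hf x
    rw [← neg_one_smul F x, hf, hneg, one_mul]
  refine ⟨U, ofFun V, W, ofFun Z, U_neg, even h.left_hom, W_neg, even h.right_hom, U_zero,
    h.left_hom.zero, W_zero, h.right_hom.zero, fun x hx => ?_, by rw [mul_comm, ZU], VW, UU, WW, ?_⟩
  · simp only [coeff_ofFun]
    rcases h.support x hx with ⟨h1, h2⟩ | ⟨h1, h2⟩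
    · exact Or.inr ⟨U_off x hx h2, h2, h1, W_unit x hx h1⟩
    · exact Or.inl ⟨U_unit x hx h2, h2, h1, W_off x hx h1⟩
  · have hV := ofFun_mul_self_eq_sum_lineElt hF hneg h.right_hom h.left_hom h.ne_zero
      h.lineSum_right h.lineSum_left
    have hZ := ofFun_mul_self_eq_sum_lineElt hF hneg h.left_hom h.right_hom h.ne_zero
      h.lineSum_left h.lineSum_right
    have hVZ : ofFun V * ofFun V + ofFun Z * ofFun Z =
        (Fintype.card F : AddMonoidAlgebra ℤ (F × F)) * ∑ i : Option F, lineElt i -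
          (Fintype.card F + 1 : AddMonoidAlgebra ℤ (F × F)) * blockSum Finset.univ := by
      rw [hV, hZ, ← Finset.sum_add_distrib]
      have h1 : ∀ i : Option F,
          Z (lineRep i) * Z (lineRep i) + V (lineRep i) * V (lineRep i) = 1 := fun i => by
        rw [add_comm]; exact h.mul_self_add_mul_self (lineRep_ne_zero i)
      simp only [← add_smul, h1, one_smul, Finset.sum_sub_distrib,
        Finset.sum_const, Finset.card_univ, Fintype.card_option, nsmul_eq_mul]
      rw [Finset.mul_sum]
      push_cast
      rfl
    rw [sum_lineElt] at hVZ
    rw [UU, Fintype.card_prod, Nat.cast_mul]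
    linear_combination hVZ

end Plane

/-! ### Eigenvectors of the Paley conference matrix -/

section QuadraticExtension

variable {p : ℕ} [Fact p.Prime] {F : Type} [Field F] [Fintype F] [DecidableEq F]
  [Algebra (ZMod p) F]

omit [Fintype F] [DecidableEq F] in
/-- Coordinates with respect to `z` and `-1`, for `z` outside the prime field. -/
lemma injective_mul_sub_algebraMap {z : F} (hz : ∀ s : ZMod p, z ≠ algebraMap (ZMod p) F s) :
    Function.Injective fun c : ZMod p × ZMod p =>
      algebraMap (ZMod p) F c.1 * z - algebraMap (ZMod p) F c.2 := by
  have hinj := (algebraMap (ZMod p) F).injective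
  rintro ⟨a, b⟩ ⟨a', b'⟩ h
  simp only at h
  have ha : a = a' := by
    by_contra hne
    have h0 : algebraMap (ZMod p) F (a - a') ≠ 0 := by
      rw [Ne, map_eq_zero]; exact sub_ne_zero.2 hne
    apply hz ((b - b') / (a - a'))
    rw [map_div₀, eq_div_iff h0, map_sub, map_sub]
    linear_combination h
  subst ha
  have : algebraMap (ZMod p) F b = algebraMap (ZMod p) F b' := by linear_combination -h
  rw [hinj this]

omit [DecidableEq F] in
lemma bijective_mul_sub_algebraMap (hF : Fintype.card F = p ^ 2) {z : F}
    (hz : ∀ s : ZMod p, z ≠ algebraMap (ZMod p) F s) :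
    Function.Bijective fun c : ZMod p × ZMod p =>
      algebraMap (ZMod p) F c.1 * z - algebraMap (ZMod p) F c.2 := by
  rw [Fintype.bijective_iff_injective_and_card]
  exact ⟨injective_mul_sub_algebraMap hz, by simp [hF, ZMod.card, sq]⟩

omit [DecidableEq F] in
lemma exists_not_mem_primeField (hF : Fintype.card F = p ^ 2) :
    ∃ z : F, ∀ s : ZMod p, z ≠ algebraMap (ZMod p) F s := by
  by_contra! h
  have h1 : Function.Surjective (algebraMap (ZMod p) F) := fun z => (h z).imp fun _ => Eq.symm
  have h2 := Fintype.card_le_of_surjective _ h1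
  rw [hF, ZMod.card] at h2
  have := (Fact.out : p.Prime).one_lt
  nlinarith

/-- Every nonzero element of the prime field is a square in a quadratic extension. -/
lemma quadraticChar_algebraMap (hp : Odd p) (hF : Fintype.card F = p ^ 2) (hchar : ringChar F ≠ 2)
    {s : ZMod p} (hs : s ≠ 0) : quadraticChar F (algebraMap (ZMod p) F s) = 1 := by
  have h0 : algebraMap (ZMod p) F s ≠ 0 := by rwa [Ne, map_eq_zero]
  rw [quadraticChar_one_iff_isSquare h0, FiniteField.isSquare_iff hchar h0, hF]
  obtain ⟨k, rfl⟩ := hp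
  have : (2 * k + 1) ^ 2 / 2 = (2 * k + 1 - 1) * (k + 1) := by
    have : (2 * k + 1) ^ 2 = 2 * (2 * k * (k + 1)) + 1 := by ring
    simp only [Nat.add_sub_cancel]
    omega
  rw [this, pow_mul, ← map_pow, ZMod.pow_card_sub_one_eq_one hs, map_one, one_pow]

lemma sum_quadraticChar_algebraMap (hp : Odd p) (hF : Fintype.card F = p ^ 2)
    (hchar : ringChar F ≠ 2) :
    ∑ s : ZMod p, quadraticChar F (algebraMap (ZMod p) F s) = p - 1 := by
  have : ∀ s : ZMod p, quadraticChar F (algebraMap (ZMod p) F s) = 1 - if s = 0 then 1 else 0 := by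
    intro s
    by_cases hs : s = 0
    · simp [hs]
    · rw [quadraticChar_algebraMap hp hF hchar hs]; simp [hs]
  simp [this, ZMod.card]

/-- The sum of the quadratic character over a translate of the prime field. -/
lemma sum_quadraticChar_sub_algebraMap (hp : Odd p) (hF : Fintype.card F = p ^ 2)
    (hchar : ringChar F ≠ 2) (z : F) :
    ∑ s : ZMod p, quadraticChar F (z - algebraMap (ZMod p) F s) =
      p * (∑ s : ZMod p, if z = algebraMap (ZMod p) F s then 1 else 0) - 1 := by
  by_cases hz : ∀ s : ZMod p, z ≠ algebraMap (ZMod p) F s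
  · simp only [hz, if_false, Finset.sum_const_zero, mul_zero, zero_sub]
    -- Every nonzero element of `F` is a multiple, by a scalar from the prime field, of `1` or of
    -- exactly one `z - s`, and the character sum over all of `F` vanishes.
    have h1 := (bijective_mul_sub_algebraMap hF hz).sum_comp (quadraticChar F)
    rw [quadraticChar_sum_zero hchar, Fintype.sum_prod_type] at h1
    have h2 : ∀ a : ZMod p,
        ∑ b, quadraticChar F (algebraMap (ZMod p) F a * z - algebraMap (ZMod p) F b) =
        if a = 0 then (p : ℤ) - 1
          else ∑ s : ZMod p, quadraticChar F (z - algebraMap (ZMod p) F s) := by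
      intro a
      by_cases ha : a = 0
      · subst ha
        simp only [map_zero, zero_mul, zero_sub, if_true, ← map_neg]
        rw [← sum_quadraticChar_algebraMap hp hF hchar]
        exact Equiv.sum_comp (Equiv.neg _) fun s => quadraticChar F (algebraMap (ZMod p) F s)
      · rw [if_neg ha, ← Equiv.sum_comp (Equiv.mulLeft₀ a ha)]
        refine Finset.sum_congr rfl fun s _ => ?_
        rw [Equiv.mulLeft₀_apply, map_mul, ← mul_sub, map_mul,
          quadraticChar_algebraMap hp hF hchar ha, one_mul]
    simp only [h2] at h1
    rw [Finset.sum_ite, Finset.sum_const, Finset.sum_const, Finset.filter_eq',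
      Finset.filter_ne'] at h1
    simp only [Finset.mem_univ, if_true, Finset.card_singleton, Finset.card_erase_of_mem,
      Finset.card_univ, ZMod.card, one_smul, nsmul_eq_mul] at h1
    have hp1 := (Fact.out : p.Prime).one_lt
    push_cast [hp1.le] at h1
    have hne : (p : ℤ) - 1 ≠ 0 := by omega
    apply mul_left_cancel₀ hne
    linarith
  · push Not at hz
    obtain ⟨b, rfl⟩ := hz
    have hinj := (algebraMap (ZMod p) F).injective
    simp only [hinj.eq_iff, Finset.sum_ite_eq, Finset.mem_univ, if_true, mul_one, ← map_sub]
    rw [← sum_quadraticChar_algebraMap hp hF hchar]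
    exact Equiv.sum_comp (Equiv.subLeft b) fun s => quadraticChar F (algebraMap (ZMod p) F s)

omit [DecidableEq F] in
/-- Signs on the cosets of the prime field: the first coordinate in `bijective_mul_sub_algebraMap`
labels the `p` cosets. -/
lemma exists_periodic_signs (hp : Odd p) (hF : Fintype.card F = p ^ 2) :
    ∃ e : F → ℤ, (∀ z, IsUnit (e z)) ∧ (∀ z (s : ZMod p), e (z + algebraMap (ZMod p) F s) = e z) ∧
      ∑ z, e z = p := by
  obtain ⟨z₀, hz₀⟩ := exists_not_mem_primeField hF
  obtain ⟨ε, hε, -, hεs⟩ := exists_signs_sum_eq_one (ι := ZMod p) (I := Finset.univ)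
    (by rwa [Finset.card_univ, ZMod.card])
  let E := Equiv.ofBijective _ (bijective_mul_sub_algebraMap hF hz₀)
  refine ⟨fun z => ε (E.symm z).1, fun z => hε _ (Finset.mem_univ _), fun z s => ?_, ?_⟩
  · obtain ⟨⟨a, b⟩, rfl⟩ := E.surjective z
    have : E (a, b) + algebraMap (ZMod p) F s = E (a, b - s) := by
      simp only [E, Equiv.ofBijective_apply, map_sub]; ring
    simp only [this, Equiv.symm_apply_apply]
  · rw [← Equiv.sum_comp E, Fintype.sum_prod_type]
    simp [← Finset.mul_sum, hεs, ZMod.card]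

/-- Functions constant on the cosets of the prime field are, up to a constant, eigenvectors of the
Paley matrix. -/
lemma sum_quadraticChar_mul_periodic (hp : Odd p) (hF : Fintype.card F = p ^ 2)
    (hchar : ringChar F ≠ 2) {e : F → ℤ}
    (he : ∀ z (s : ZMod p), e (z + algebraMap (ZMod p) F s) = e z) (hes : ∑ z, e z = p) (t : F) :
    ∑ r, quadraticChar F r * e (r + t) = p * e t - 1 := by
  have hp0 : (p : ℤ) ≠ 0 := by exact_mod_cast (Fact.out : p.Prime).ne_zero
  apply mul_left_cancel₀ hp0
  -- By periodicity of `e` the character may be averaged over a translate of the prime field.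
  have h1 : ∀ s : ZMod p, ∑ r, quadraticChar F r * e (r + t) =
      ∑ r, quadraticChar F (r - algebraMap (ZMod p) F s) * e (r + t) := by
    intro s
    rw [← Equiv.sum_comp (Equiv.subRight (algebraMap (ZMod p) F s))]
    refine Finset.sum_congr rfl fun r _ => ?_
    rw [Equiv.subRight_apply, ← he (r - algebraMap (ZMod p) F s + t) s]
    congr 2
    ring
  have h2 : ∑ r, e (r + t) = p := by
    rw [← hes]; exact Equiv.sum_comp (Equiv.addRight t) e
  calc (p : ℤ) * ∑ r, quadraticChar F r * e (r + t)
      = ∑ s : ZMod p, ∑ r, quadraticChar F (r - algebraMap (ZMod p) F s) * e (r + t) := by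
        rw [← Finset.sum_congr rfl fun s _ => h1 s]
        simp [ZMod.card]
    _ = ∑ r, (p * (∑ s : ZMod p, if r = algebraMap (ZMod p) F s then 1 else 0) - 1) *
          e (r + t) := by
        rw [Finset.sum_comm]
        refine Finset.sum_congr rfl fun r _ => ?_
        rw [← sum_quadraticChar_sub_algebraMap hp hF hchar, Finset.sum_mul]
    _ = p * ∑ s : ZMod p, e (algebraMap (ZMod p) F s + t) - p := by
        simp only [sub_mul, one_mul, Finset.sum_sub_distrib, h2, mul_assoc, ← Finset.mul_sum,
          Finset.sum_mul, ite_mul, zero_mul]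
        rw [Finset.sum_comm]
        simp
    _ = p * (p * e t - 1) := by
        have : ∀ s : ZMod p, e (algebraMap (ZMod p) F s + t) = e t := fun s => by
          rw [add_comm, he]
        simp only [this, Finset.sum_const, Finset.card_univ, ZMod.card, nsmul_eq_mul]
        ring

/-- The homogeneous function on the plane with values `e z` at `(z, 1)` and `1` at `(1, 0)`. -/
def homogenize (e : F → ℤ) (v : F × F) : ℤ :=
  if v.2 = 0 then quadraticChar F v.1 else quadraticChar F v.2 * e (v.1 / v.2)

lemma isQuadHomogeneous_homogenize (e : F → ℤ) : IsQuadHomogeneous (homogenize e) := by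
  rintro a ⟨x, y⟩
  by_cases ha : a = 0
  · subst ha; simp [homogenize]
  · by_cases hy : y = 0
    · simp only [homogenize, Prod.smul_mk, smul_eq_mul, hy, mul_zero, if_true, map_mul]
    · simp only [homogenize, Prod.smul_mk, smul_eq_mul, mul_eq_zero, ha, hy, or_self, if_false,
        map_mul, mul_div_mul_left x y ha, mul_assoc]

lemma isUnit_homogenize {e : F → ℤ} (he : ∀ z, IsUnit (e z)) {v : F × F} (hv : v ≠ 0) :
    IsUnit (homogenize e v) := by
  obtain ⟨x, y⟩ := v
  have hχ : ∀ {a : F}, a ≠ 0 → IsUnit (quadraticChar F a) := fun ha =>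
    Int.isUnit_iff.2 (quadraticChar_dichotomy ha)
  by_cases hy : y = 0
  · have hx : x ≠ 0 := fun h => hv (by simp [h, hy])
    simpa only [homogenize, hy, if_true] using hχ hx
  · simp only [homogenize, hy, if_false]
    exact (hχ hy).mul (he _)

lemma quadraticChar_inv (a : F) : quadraticChar F a⁻¹ = quadraticChar F a := by
  by_cases ha : a = 0
  · simp [ha]
  · have h1 : quadraticChar F a * quadraticChar F a⁻¹ = 1 := by
      rw [← map_mul, mul_inv_cancel₀ ha, map_one]
    rcases quadraticChar_dichotomy ha with h | h <;> rw [h] at h1 ⊢ <;> omega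

/-- The eigenvector equation. The condition that the values of `e` sum to `p` is the equation at the
line of slope `none`. -/
lemma lineSum_homogenize (hp : Odd p) (hF : Fintype.card F = p ^ 2) (hchar : ringChar F ≠ 2)
    (hneg : quadraticChar F (-1) = 1) {e : F → ℤ}
    (he : ∀ z (s : ZMod p), e (z + algebraMap (ZMod p) F s) = e z) (hes : ∑ z, e z = p)
    (u : F × F) : lineSum (homogenize e) u = p * homogenize e u := by
  obtain ⟨a, b⟩ := u
  rw [lineSum, Fintype.sum_prod_type_right]
  have hdet : ∀ x y : F, detForm (x, y) (a, b) = x * b - y * a := fun _ _ => rfl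
  by_cases hb : b = 0
  · subst hb
    by_cases ha : a = 0
    · subst ha; simp [homogenize, detForm]
    · have ha' : -a⁻¹ ≠ 0 := neg_ne_zero.2 (inv_ne_zero ha)
      have h1 : ∀ y : F, (∑ x : F, if detForm (x, y) (a, 0) = 1 then homogenize e (x, y) else 0) =
          if y = -a⁻¹ then ∑ x : F, homogenize e (x, y) else 0 := by
        intro y
        have : ∀ x, detForm (x, y) (a, 0) = 1 ↔ y = -a⁻¹ := fun x => by
          rw [hdet]
          constructor
          · intro h
            apply mul_right_cancel₀ ha
            rw [neg_mul, inv_mul_cancel₀ ha]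
            linear_combination -h
          · rintro rfl
            simp [ha]
        simp only [this]
        split_ifs <;> simp
      have h2 : ∑ x, e (x / -a⁻¹) = p := by
        rw [← hes]; exact Equiv.sum_comp (Equiv.divRight₀ (-a⁻¹) ha') e
      have h3 : quadraticChar F (-a⁻¹) = quadraticChar F a := by
        rw [← neg_one_mul, map_mul, hneg, one_mul, quadraticChar_inv]
      have h4 : ∀ x, homogenize e (x, -a⁻¹) = quadraticChar F a * e (x / -a⁻¹) := fun x => by
        rw [homogenize, if_neg ha', h3]
      have h5 : homogenize e (a, 0) = quadraticChar F a := by rw [homogenize, if_pos rfl]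
      rw [Finset.sum_congr rfl fun y _ => h1 y, Finset.sum_ite_eq', if_pos (Finset.mem_univ _),
        Finset.sum_congr rfl fun x _ => h4 x, ← Finset.mul_sum, h2, h5, mul_comm]
  · have h1 : ∀ y : F, (∑ x : F, if detForm (x, y) (a, b) = 1 then homogenize e (x, y) else 0) =
        homogenize e ((1 + y * a) / b, y) := by
      intro y
      rw [Finset.sum_eq_single ((1 + y * a) / b)]
      · rw [if_pos (by rw [hdet]; field_simp; ring)]
      · intro x _ hx
        rw [if_neg]
        intro h
        apply hx
        rw [hdet] at h
        rw [eq_div_iff hb]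
        linear_combination h
      · simp
    -- The substitution `y = (r b)⁻¹`, where `r = 0` corresponds to the point with `y = 0`.
    have hinv : Function.Involutive fun r : F => (r * b)⁻¹ := by
      intro r
      simp only [mul_inv, inv_inv]
      rw [mul_assoc, mul_inv_cancel₀ hb, mul_one]
    have h2 : ∀ r : F, homogenize e ((1 + (r * b)⁻¹ * a) / b, (r * b)⁻¹) =
        quadraticChar F b * (quadraticChar F r * e (r + a / b)) +
          if r = 0 then quadraticChar F b else 0 := by
      intro r
      by_cases hr : r = 0
      · subst hr
        have h0 : quadraticChar F 0 = 0 := MulChar.map_zero _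
        simp [homogenize, quadraticChar_inv, h0, -quadraticChar_apply]
      · have hrb : (r * b)⁻¹ ≠ 0 := inv_ne_zero (mul_ne_zero hr hb)
        have : (1 + (r * b)⁻¹ * a) / b / (r * b)⁻¹ = r + a / b := by field_simp
        simp only [homogenize, hrb, if_false, this, quadraticChar_inv, map_mul, hr, add_zero]
        ring
    have h3 : homogenize e (a, b) = quadraticChar F b * e (a / b) := by
      rw [homogenize, if_neg hb]
    rw [Finset.sum_congr rfl fun y _ => h1 y, ← Equiv.sum_comp hinv.toPerm]
    simp only [Function.Involutive.coe_toPerm]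
    rw [Finset.sum_congr rfl fun r _ => h2 r, Finset.sum_add_distrib, ← Finset.mul_sum,
      sum_quadraticChar_mul_periodic hp hF hchar he hes, Finset.sum_ite_eq',
      if_pos (Finset.mem_univ _), h3]
    ring

/-- Stretching the second coordinate by a nonsquare changes the sign of the eigenvalue of
`lineSum`. -/
lemma lineSum_comp_stretch (hchar : ringChar F ≠ 2) {w : F × F → ℤ} (hw : IsQuadHomogeneous w)
    {c : ℤ} (hc : ∀ u, lineSum w u = c * w u) {ν : F} (hν : quadraticChar F ν = -1) (u : F × F) :
    lineSum (fun v => w (v.1, ν * v.2)) u = -c * w (u.1, ν * u.2) := by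
  have hν0 : ν ≠ 0 := by rintro rfl; simp at hν
  have h := sum_detForm_eq hchar hw (u.1, ν * u.2) ν
  rw [hν, hc, ← Equiv.sum_comp ((Equiv.refl F).prodCongr (Equiv.mulLeft₀ ν hν0))] at h
  rw [lineSum, neg_mul, ← neg_one_mul, ← h]
  refine Finset.sum_congr rfl fun v _ => ?_
  have : detForm (v.1, ν * v.2) (u.1, ν * u.2) = ν * detForm v u := by simp only [detForm]; ring
  have h2 : (Equiv.refl F).prodCongr (Equiv.mulLeft₀ ν hν0) v = (v.1, ν * v.2) := rfl
  rw [h2, this]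
  simp [hν0]

/-- Half the sum and half the difference of eigenvectors with opposite eigenvalues. -/
lemma exists_isLineSumPair (hp : Odd p) (hF : Fintype.card F = p ^ 2) (hchar : ringChar F ≠ 2)
    (hneg : quadraticChar F (-1) = 1) : ∃ (V Z : F × F → ℤ) (c : ℤ), IsLineSumPair V Z c := by
  obtain ⟨e, he1, he, hes⟩ := exists_periodic_signs (F := F) hp hF
  obtain ⟨ν, hν⟩ := quadraticChar_exists_neg_one hchar
  have hν0 : ν ≠ 0 := by rintro rfl; simp at hν
  set w := homogenize e with hw_def
  set w' : F × F → ℤ := fun v => w (v.1, ν * v.2) with hw'_def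
  have hw : IsQuadHomogeneous w := isQuadHomogeneous_homogenize e
  have hw' : IsQuadHomogeneous w' := by
    intro a v
    have := hw a (v.1, ν * v.2)
    simp only [hw'_def, ← this, Prod.smul_mk, Prod.smul_fst, Prod.smul_snd, smul_eq_mul,
      mul_left_comm]
  have hT : ∀ u, lineSum w u = p * w u := lineSum_homogenize hp hF hchar hneg he hes
  have hT' : ∀ u, lineSum w' u = -p * w' u := lineSum_comp_stretch hchar hw hT hν
  have hu : ∀ v, v ≠ 0 → IsUnit (w v) := fun v hv => isUnit_homogenize he1 hv
  have hu' : ∀ v, v ≠ 0 → IsUnit (w' v) := fun v hv => hu _ fun h => hv (by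
    simpa [Prod.ext_iff, hν0] using h)
  let V : F × F → ℤ := fun v => if w v = w' v then w v else 0
  let Z : F × F → ℤ := fun v => if w v = w' v then 0 else w v
  have hval : ∀ v, 2 * V v = w v + w' v ∧ 2 * Z v = w v - w' v := by
    intro v
    by_cases hv : v = 0
    · subst hv; simp [V, Z, hw.zero, hw'.zero]
    · rcases Int.isUnit_iff.1 (hu v hv) with h | h <;>
        rcases Int.isUnit_iff.1 (hu' v hv) with h' | h' <;> simp [V, Z, h, h']
  have hsum : ∀ (f : F × F → ℤ) u, 2 * lineSum f u = ∑ v, if detForm v u = 1 then 2 * f v else 0 :=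
    fun f u => by simp [lineSum, Finset.mul_sum]
  have hsumV : ∀ u, 2 * lineSum V u = lineSum w u + lineSum w' u := by
    intro u
    rw [hsum, lineSum, lineSum, ← Finset.sum_add_distrib]
    exact Finset.sum_congr rfl fun v _ => by rw [(hval v).1]; split_ifs <;> simp
  have hsumZ : ∀ u, 2 * lineSum Z u = lineSum w u - lineSum w' u := by
    intro u
    rw [hsum, lineSum, lineSum, ← Finset.sum_sub_distrib]
    exact Finset.sum_congr rfl fun v _ => by rw [(hval v).2]; split_ifs <;> simp
  refine ⟨V, Z, p, fun a v => ?_, fun a v => ?_, ?_, fun u => ?_, fun u => ?_, fun v hv => ?_⟩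
  · have := (hval (a • v)).1
    rw [hw a, hw' a] at this
    apply mul_left_cancel₀ (two_ne_zero (α := ℤ))
    linear_combination this - quadraticChar F a * (hval v).1
  · have := (hval (a • v)).2
    rw [hw a, hw' a] at this
    apply mul_left_cancel₀ (two_ne_zero (α := ℤ))
    linear_combination this - quadraticChar F a * (hval v).2
  · exact_mod_cast (Fact.out : p.Prime).ne_zero
  · have h1 := hsumV u
    rw [hT, hT'] at h1
    apply mul_left_cancel₀ (two_ne_zero (α := ℤ))
    linear_combination h1 - p * (hval u).2
  · have h1 := hsumZ u
    rw [hT, hT'] at h1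
    apply mul_left_cancel₀ (two_ne_zero (α := ℤ))
    linear_combination h1 - p * (hval u).1
  · by_cases h : w v = w' v
    · exact Or.inl ⟨by simpa [V, h] using hu' v hv, by simp [Z, h]⟩
    · exact Or.inr ⟨by simp [V, h], by simpa [Z, h] using hu v hv⟩

end QuadraticExtension

/-! ### Existence of the families -/

/-- The plane over `𝔽_{p²}` is a model of `ℤ_p⁴`. -/
theorem hasRowQuadruple_fin_four_zmod {p : ℕ} [Fact p.Prime] (hp : Odd p) :
    HasRowQuadruple (Fin 4 → ZMod p) := by
  classical
  let F := GaloisField p 2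
  have : Fintype F := Fintype.ofFinite F
  have hF : Fintype.card F = p ^ 2 := by
    rw [← Nat.card_eq_fintype_card, GaloisField.card p 2 two_ne_zero]
  have hchar : ringChar F ≠ 2 := by
    rw [ringChar.eq F p]
    rintro rfl
    exact absurd hp (by decide)
  have h4 : Fintype.card F % 4 = 1 := by
    rw [hF, Nat.pow_mod]
    have : p % 4 = 1 ∨ p % 4 = 3 := by obtain ⟨k, rfl⟩ := hp; omega
    rcases this with h | h <;> simp [h]
  have hneg : quadraticChar F (-1) = 1 := by
    rw [quadraticChar_one_iff_isSquare (neg_ne_zero.2 one_ne_zero),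
      FiniteField.isSquare_neg_one_iff, h4]
    decide
  obtain ⟨V, Z, c, h⟩ := exists_isLineSumPair (F := F) hp hF hchar hneg
  refine (h.hasRowQuadruple hchar h4 hneg).of_addEquiv
    (LinearEquiv.ofFinrankEq (R := ZMod p) _ _ ?_).toAddEquiv
  simp [F, GaloisField.finrank p two_ne_zero]

theorem mainTheorem8 (m : ℕ) (hm : m = 0 ∨ m = 2)
    (s : ℕ) (p : Fin s → ℕ) [∀ i, Fact (p i).Prime] (hodd : ∀ i, Odd (p i))
    (hdist : Function.Injective p) (t : Fin s → ℕ) :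
    ∃ D : Fin 4 → Finset ((Fin m → ZMod 3) × (∀ i : Fin s, Fin (4 * t i) → ZMod (p i))),
      IsTypeH D ∧ IsSymmetricFamily D ∧
        CondD1 D ∧ CondD2 D ∧ CondD3 D ∧ CondD4 D ∧ CondD5 D := by
  have hN : HasRowQuadruple (Fin m → ZMod 3) := by
    rcases hm with rfl | rfl
    · exact hasRowQuadruple_of_subsingleton _
    · exact hasRowQuadruple_fin_two_zmod_three
  have hP : HasRowQuadruple (∀ i : Fin s, Fin (4 * t i) → ZMod (p i)) :=
    hasRowQuadruple_pi _ fun i =>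
      hasRowQuadruple_fin_four_mul (hasRowQuadruple_fin_four_zmod (hodd i)) (t i)
  obtain ⟨U, V, W, Z, h⟩ := hN.prod hP
  exact exists_family_of_rowQuadruple h
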